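/- **Theorem 3.6 (Ruelle–Perron–Frobenius).** Let $n\ge 3$. For $1\le j\le n-1$ let $$\gamma_j(y_1,\dots,y_n)=\Bigl(y_1,\dots,\widehat{y_j},\dots,y_n,\ \sum_{i\ne j}y_i\Bigr),$$ and let $T_\Gamma=\{\gamma_{n-1}^{A}\gamma_j : A\in\mathbf Z_{\ge 0},\ 1\le j\le n-2\}$. Let $$\Delta=\Bigl\{(w_1,\dots,w_{n-1}) : 0\le w_1\le\dots\le w_{n-1},\ \sum_{i=1}^{n-1} w_i=1\Bigr\},$$ identify $w\in\Delta$ with $(w_1,\dots,w_{n-1},w_n)$, where $w_n=1$, and let $\gamma\in T_\Gamma$ act on $\Delta$ by applying the linear map $\gamma$ to this $n$-tuple and dividing by the last coordinate of the result. Let $C^1(\Delta)$ be the space of complex-valued continuously differentiable functions on $\Delta$, with norm $\|f\|_\infty+\|\nabla f\|_\infty$ for the Euclidean metric in the coordinates $w_1,\dots,w_{n-1}$. For real $s>1$ put $$\mathcal L_s[f](w)=\sum_{\gamma\in T_\Gamma}\Bigl(\frac{w_n}{(\gamma w)_n}\Bigr)^{s} f(\gamma.w),$$ where $(\gamma w)_n$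 is the last coordinate of the image of $(w_1,\dots,w_{n-1},1)$ under the linear map $\gamma$. The series converges absolutely at every point for every continuous $f$, and $\mathcal L_s$ is a bounded operator on $C^0(\Delta)$ and on $C^1(\Delta)$. There are functions $s\mapsto\lambda_s>0$ and $s\mapsto R(s)\ge 0$ on $(1,\infty)$ such that the following holds. 1. For every $s>1$, $\lambda_s$ is an eigenvalue of $\mathcal L_s:C^1(\Delta)\to C^1(\Delta)$ of algebraic multiplicity one (that is, $\ker(\mathcal L_s-\lambda_s)$ is one-dimensional and $C^1(\Delta)=\ker(\mathcal L_s-\lambda_s)\oplus\operatorname{im}(\mathcal L_s-\lambda_s)$), and the rest of the spectrum of $\mathcal L_s$ on $C^1(\Delta)$ is contained in the disk $\{|z|\le R(s)\}$, where $R(s)<\lambda_s$. For every compact interval $I\subset(1,\infty)$ there is $\epsilon=\epsilon(I)>0$ such that $\lambda_s-R(s)\ge\epsilon$ for all $s\in I$. 2. For every $s>1$ there is a unique Borel probability measure $\nu_s$ on $\Delta$ with $\mathcal L_s^*\nu_s=\lambda_s\nu_s$, where $\mathcal L_s^*$ is the dual of $\mathcal L_s$ on $C^0(\Delta)$; moreover,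 if $\mathcal L_s^*\nu=\mu\nu$ for a probability measure $\nu$ and a real number $\mu$, then $\mu=\lambda_s$ (and hence $\nu=\nu_s$). 3. For every $s>1$ there is a unique $h_s\in C^1(\Delta)$ with $\mathcal L_sh_s=\lambda_sh_s$ and $\nu_s(h_s)=1$, and $h_s$ is real-valued and strictly positive at every point of $\Delta$. -/

import Mathlib

open scoped BigOperators

namespace MarkoffHurwitz

noncomputable section

/-! Throughout `d = n - 2`, so that `n`-tuples are indexed by `Fin (d + 2)`, `(n-1)`-tuples by
`Fin (d + 1)`, and the `n - 2` indices `1, …, n - 2` by `Fin d` (everything is counted from `0`). -/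

/-- The map `γ_j`, `1 ≤ j ≤ n - 1`: omit the entry `y_j` and append the sum of the other entries,
`γ_j (y_1, …, y_n) = (y_1, …, y_{j-1}, y_{j+1}, …, y_n, ∑_{i ≠ j} y_i)`. -/
def gen {d : ℕ} (j : Fin (d + 1)) (y : Fin (d + 2) → ℝ) : Fin (d + 2) → ℝ :=
  Fin.snoc (α := fun _ => ℝ) (fun i : Fin (d + 1) => y (j.castSucc.succAbove i))
    (∑ i : Fin (d + 1), y (j.castSucc.succAbove i))

/-- The index set of `T_Γ = {γ_{n-1}^A γ_j : A ≥ 0, 1 ≤ j ≤ n - 2}`: the pairs `(A, j)`. -/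
abbrev Branch (d : ℕ) : Type := ℕ × Fin d

/-- The element `γ_{n-1}^A γ_j` of `T_Γ`, acting on `n`-tuples. -/
def branch {d : ℕ} (γ : Branch d) (y : Fin (d + 2) → ℝ) : Fin (d + 2) → ℝ :=
  (gen (Fin.last d))^[γ.1] (gen γ.2.castSucc y)

/-- The cone `ℋ` of nondecreasing nonnegative `n`-tuples with `y_1 + ⋯ + y_{n-1} = y_n`. -/
def cone (d : ℕ) : Set (Fin (d + 2) → ℝ) :=
  {y | (∀ i, 0 ≤ y i) ∧ Monotone y ∧ ∑ i : Fin (d + 1), y i.castSucc = y (Fin.last (d + 1))}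

/-- `Δ = ℋ / ℝ₊`, each class being represented by its point with `w_n = 1`, in the coordinates
`(w_1, …, w_{n-1})`: nonnegative nondecreasing tuples of sum `1`, with the Euclidean metric. -/
def simplex (d : ℕ) : Set (EuclideanSpace ℝ (Fin (d + 1))) :=
  {w | (∀ i, 0 ≤ w i) ∧ (∀ i j, i ≤ j → w i ≤ w j) ∧ ∑ i, w i = 1}

/-- `Δ` as a compact metric space, with its Borel σ-algebra. -/
abbrev Simplex (d : ℕ) : Type := simplex d

theorem isCompact_simplex (d : ℕ) : IsCompact (simplex d) := by
  apply Metric.isCompact_of_isClosed_isBounded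
  · have h : simplex d = (⋂ i, {w | 0 ≤ w i}) ∩ ((⋂ i, ⋂ j, ⋂ _ : i ≤ j, {w | w i ≤ w j}) ∩
        {w | ∑ i, w i = 1}) := by
      ext w; simp [simplex]
    rw [h]
    refine (isClosed_iInter fun i => isClosed_le (by fun_prop) (by fun_prop)).inter
      ((isClosed_iInter fun i => isClosed_iInter fun j => isClosed_iInter fun _ =>
        isClosed_le (by fun_prop) (by fun_prop)).inter
        (isClosed_eq (by fun_prop) (by fun_prop)))
  · refine (Metric.isBounded_closedBall (x := 0) (r := Real.sqrt (d + 1))).subset fun w hw => ?_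
    rw [mem_closedBall_zero_iff, EuclideanSpace.norm_eq]
    apply Real.sqrt_le_sqrt
    have h1 : ∀ i, w i ≤ 1 := fun i => by
      rw [← hw.2.2]; exact Finset.single_le_sum (fun k _ => hw.1 k) (Finset.mem_univ i)
    calc ∑ i, ‖w i‖ ^ 2 ≤ ∑ _i : Fin (d + 1), (1 : ℝ) := by
          refine Finset.sum_le_sum fun i _ => ?_
          rw [Real.norm_eq_abs, sq_abs]
          nlinarith [hw.1 i, h1 i]
      _ = d + 1 := by simp

instance (d : ℕ) : CompactSpace (Simplex d) := isCompact_iff_compactSpace.mp (isCompact_simplex d)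

/-- The representative `(w_1, …, w_{n-1}, 1)` of a point of `Δ`. -/
def lift {d : ℕ} (w : Simplex d) : Fin (d + 2) → ℝ :=
  Fin.snoc (α := fun _ => ℝ) (fun i : Fin (d + 1) => w.1 i) 1

theorem lift_mem_cone {d : ℕ} (w : Simplex d) : lift w ∈ cone d := by
  obtain ⟨w, h0, hm, hs⟩ := w
  have h1 : ∀ i, w i ≤ 1 := fun i => by
    rw [← hs]; exact Finset.single_le_sum (fun k _ => h0 k) (Finset.mem_univ i)
  refine ⟨fun i => ?_, fun i j hij => ?_, ?_⟩
  · induction i using Fin.lastCases <;> simp [lift, h0]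
  · induction j using Fin.lastCases with
    | last => induction i using Fin.lastCases <;> simp [lift, h1]
    | cast j =>
      induction i using Fin.lastCases with
      | last => exact absurd hij (not_le.mpr (Fin.castSucc_lt_last j))
      | cast i => simpa [lift] using hm i j (by simpa using hij)
  · simp [lift, hs]

theorem gen_mem_cone {d : ℕ} (j : Fin (d + 1)) {y : Fin (d + 2) → ℝ} (hy : y ∈ cone d) :
    gen j y ∈ cone d := by
  obtain ⟨h0, hm, hs⟩ := hy
  refine ⟨fun i => ?_, fun i k hik => ?_, by simp [gen]⟩
  · induction i using Fin.lastCases with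
    | last => simpa [gen] using Finset.sum_nonneg fun i _ => h0 _
    | cast i => simpa [gen] using h0 _
  · induction k using Fin.lastCases with
    | last =>
      induction i using Fin.lastCases with
      | last => exact le_rfl
      | cast i =>
        simpa [gen] using Finset.single_le_sum (f := fun i => y (j.castSucc.succAbove i))
          (fun k _ => h0 _) (Finset.mem_univ i)
    | cast k =>
      induction i using Fin.lastCases with
      | last => exact absurd hik (not_le.mpr (Fin.castSucc_lt_last k))
      | cast i =>
        simpa [gen] using hm ((Fin.strictMono_succAbove _).monotone (by simpa using hik))

theorem gen_last_pos {d : ℕ} (j : Fin (d + 1)) {y : Fin (d + 2) → ℝ} (hy : y ∈ cone d)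
    (hpos : 0 < y (Fin.last (d + 1))) : 0 < gen j y (Fin.last (d + 1)) := by
  obtain ⟨h0, -, -⟩ := hy
  have h : y (j.castSucc.succAbove (Fin.last d)) ≤ ∑ i, y (j.castSucc.succAbove i) :=
    Finset.single_le_sum (f := fun i => y (j.castSucc.succAbove i)) (fun k _ => h0 _)
      (Finset.mem_univ _)
  rw [Fin.succAbove_of_lt_succ _ _ (by simp [Fin.lt_def]; omega)] at h
  simp only [Fin.succ_last] at h
  simpa [gen] using hpos.trans_le h

theorem iterate_gen_mem {d : ℕ} (A : ℕ) (j : Fin (d + 1)) {y : Fin (d + 2) → ℝ}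
    (hy : y ∈ cone d) (hpos : 0 < y (Fin.last (d + 1))) :
    (gen j)^[A] y ∈ cone d ∧ 0 < (gen j)^[A] y (Fin.last (d + 1)) := by
  induction A with
  | zero => exact ⟨hy, hpos⟩
  | succ A ih =>
    rw [Function.iterate_succ_apply']
    exact ⟨gen_mem_cone j ih.1, gen_last_pos j ih.1 ih.2⟩

theorem branch_lift_mem {d : ℕ} (γ : Branch d) (w : Simplex d) :
    branch γ (lift w) ∈ cone d ∧ 0 < branch γ (lift w) (Fin.last (d + 1)) :=
  iterate_gen_mem _ _ (gen_mem_cone _ (lift_mem_cone w))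
    (gen_last_pos _ (lift_mem_cone w) (by simp [lift]))

/-- The projection `ℋ \ {0} → Δ`, `y ↦ (y_1, …, y_{n-1}) / y_n`. -/
def proj {d : ℕ} (y : Fin (d + 2) → ℝ) (hy : y ∈ cone d) (hpos : 0 < y (Fin.last (d + 1))) :
    Simplex d :=
  ⟨WithLp.toLp 2 fun i : Fin (d + 1) => y i.castSucc / y (Fin.last (d + 1)),
    fun i => div_nonneg (hy.1 _) hpos.le,
    fun i j hij => div_le_div_of_nonneg_right (hy.2.1 (by simpa using hij)) hpos.le,
    by simp only [← Finset.sum_div, hy.2.2, div_self hpos.ne']⟩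

/-- The action `w ↦ γ.w` of an element of `T_Γ` on `Δ`. -/
def act {d : ℕ} (γ : Branch d) (w : Simplex d) : Simplex d :=
  proj (branch γ (lift w)) (branch_lift_mem γ w).1 (branch_lift_mem γ w).2

/-- The factor `(w_n / (γ.w)_n) ^ s` (computed with any representative; here `w_n = 1`). -/
def weight {d : ℕ} (s : ℝ) (γ : Branch d) (w : Simplex d) : ℝ :=
  (lift w (Fin.last (d + 1)) / branch γ (lift w) (Fin.last (d + 1))) ^ s

/-- `g = ℒ_s[f]`: at every point `w` of `Δ` the series
`∑_{γ ∈ T_Γ} (w_n / (γ.w)_n) ^ s f(γ.w)` is (absolutely) summable and has the sum `g w`. -/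
def IsTransfer {d : ℕ} (s : ℝ) (f g : Simplex d → ℂ) : Prop :=
  ∀ w, HasSum (fun γ : Branch d => (weight s γ w : ℂ) * f (act γ w)) (g w)

/-- `G` is a gradient of `f` on `Δ`: `G w` is tangent to the hyperplane `∑ w_i = const`, and
`f z = f w + ∑ G_i(w) (z_i - w_i) + o(|z - w|)` as `z → w` in `Δ`, at every point `w` of `Δ`. -/
def IsGradient {d : ℕ} (f : Simplex d → ℂ) (G : Simplex d → EuclideanSpace ℂ (Fin (d + 1))) :
    Prop :=
  ∀ w, ∑ i, G w i = 0 ∧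
    (fun z : Simplex d => f z - f w - ∑ i, G w i * ((z.1 i - w.1 i : ℝ) : ℂ))
      =o[nhds w] fun z : Simplex d => z.1 - w.1

/-- The point of `Δ` proportional to a nondecreasing tuple of positive numbers. -/
def normalize {d : ℕ} (c : Fin (d + 1) → ℝ) (hc : ∀ i, 0 < c i) (hm : Monotone c) : Simplex d :=
  ⟨WithLp.toLp 2 fun i => c i / ∑ k, c k,
    fun i => div_nonneg (hc i).le (Finset.sum_nonneg fun k _ => (hc k).le),
    fun i j hij => div_le_div_of_nonneg_right (hm hij) (Finset.sum_nonneg fun k _ => (hc k).le),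
    by
      simp only [← Finset.sum_div]
      exact div_self (Finset.sum_pos (fun k _ => hc k) Finset.univ_nonempty).ne'⟩

theorem IsGradient.unique {d : ℕ} {f : Simplex d → ℂ}
    {G G' : Simplex d → EuclideanSpace ℂ (Fin (d + 1))} (hG : IsGradient f G)
    (hG' : IsGradient f G') : G = G' := by
  funext w
  set D : Fin (d + 1) → ℂ := fun i => G w i - G' w i with hD
  have hD0 : ∑ i, D i = 0 := by simp [hD, (hG w).1, (hG' w).1]
  have ho : (fun z : Simplex d => ∑ i, D i * ((z.1 i - w.1 i : ℝ) : ℂ))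
      =o[nhds w] fun z : Simplex d => z.1 - w.1 := by
    refine ((hG' w).2.sub (hG w).2).congr_left fun z => ?_
    simp only [hD, sub_mul, Finset.sum_sub_distrib]
    ring
  have key : ∀ u : Simplex d, ∑ i, D i * ((u.1 i - w.1 i : ℝ) : ℂ) = 0 := by
    intro u
    set c := ∑ i, D i * ((u.1 i - w.1 i : ℝ) : ℂ) with hc
    have hmem : ∀ t : Set.Icc (0 : ℝ) 1, w.1 + t.1 • (u.1 - w.1) ∈ simplex d := by
      rintro ⟨t, ht0, ht1⟩
      have e : ∀ i, (w.1 + t • (u.1 - w.1)) i = (1 - t) * w.1 i + t * u.1 i := fun i => by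
        simp; ring
      have h1t : 0 ≤ 1 - t := by linarith
      refine ⟨fun i => ?_, fun i j hij => ?_, ?_⟩
      · rw [e]
        exact add_nonneg (mul_nonneg h1t (w.2.1 i)) (mul_nonneg ht0 (u.2.1 i))
      · rw [e, e]
        exact add_le_add (mul_le_mul_of_nonneg_left (w.2.2.1 i j hij) h1t)
          (mul_le_mul_of_nonneg_left (u.2.2.1 i j hij) ht0)
      · simp only [e, Finset.sum_add_distrib, ← Finset.mul_sum, w.2.2.2, u.2.2.2]
        ring
    let z : Set.Icc (0 : ℝ) 1 → Simplex d := fun t => ⟨_, hmem t⟩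
    let t₀ : ℕ → Set.Icc (0 : ℝ) 1 := fun k =>
      ⟨1 / ((k : ℝ) + 1), by positivity, by
        rw [div_le_one (by positivity)]; linarith [Nat.cast_nonneg (α := ℝ) k]⟩
    have ht : Filter.Tendsto (fun k => (t₀ k).1) Filter.atTop (nhds 0) :=
      tendsto_one_div_add_atTop_nhds_zero_nat
    have hz : Filter.Tendsto (fun k => z (t₀ k)) Filter.atTop (nhds w) := by
      rw [tendsto_subtype_rng]
      have := (ht.smul_const (u.1 - w.1)).const_add w.1
      simpa using this
    have h2 := (ho.comp_tendsto hz).bound (c := ‖c‖ / (2 * (‖u.1 - w.1‖ + 1)))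
    by_contra hne
    have hcpos : 0 < ‖c‖ := norm_pos_iff.mpr hne
    obtain ⟨k, hk⟩ := (h2 (by positivity)).exists
    have htk : 0 < (t₀ k).1 := by simp only [t₀]; positivity
    have hl : ∑ i, D i * (((z (t₀ k)).1 i - w.1 i : ℝ) : ℂ) = ((t₀ k).1 : ℂ) * c := by
      rw [hc, Finset.mul_sum]
      refine Finset.sum_congr rfl fun i _ => ?_
      simp only [z, PiLp.add_apply, PiLp.smul_apply, PiLp.sub_apply, smul_eq_mul]
      push_cast; ring
    have hr : (z (t₀ k)).1 - w.1 = (t₀ k).1 • (u.1 - w.1) := by simp [z]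
    simp only [Function.comp_apply, hl, hr, norm_mul, norm_smul, Complex.norm_real,
      Real.norm_eq_abs, abs_of_pos htk] at hk
    have h3 : ‖c‖ / (2 * (‖u.1 - w.1‖ + 1)) * ‖u.1 - w.1‖ < ‖c‖ := by
      rw [div_mul_eq_mul_div, div_lt_iff₀ (by positivity)]
      nlinarith [norm_nonneg (u.1 - w.1)]
    nlinarith [mul_lt_mul_of_pos_left h3 htk]
  have key2 : ∀ c : Fin (d + 1) → ℝ, (∀ i, 0 < c i) → Monotone c →
      ∑ i, D i * (c i : ℂ) = (∑ i, D i * (w.1 i : ℂ)) * ((∑ k, c k : ℝ) : ℂ) := by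
    intro c hc hm
    have h := key (normalize c hc hm)
    have hS : ((∑ k, c k : ℝ) : ℂ) ≠ 0 := by
      exact_mod_cast (Finset.sum_pos (fun k _ => hc k) Finset.univ_nonempty).ne'
    rw [← sub_eq_zero]
    calc _ = (∑ i, D i * (((normalize c hc hm).1 i - w.1 i : ℝ) : ℂ)) *
          ((∑ k, c k : ℝ) : ℂ) := by
          rw [Finset.sum_mul, Finset.sum_mul, ← Finset.sum_sub_distrib]
          refine Finset.sum_congr rfl fun i _ => ?_
          simp only [normalize]
          rw [Complex.ofReal_sub, Complex.ofReal_div, mul_assoc (D i) _ _, mul_assoc (D i) _ _,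
            ← mul_sub, sub_mul (_ / _), div_mul_cancel₀ _ hS]
      _ = 0 := by rw [h, zero_mul]
  set C := ∑ i, D i * (w.1 i : ℂ)
  have hDC : ∀ k, D k = C := by
    intro k
    have hp : ∀ i : Fin (d + 1), (0 : ℝ) < (i : ℕ) + 1 := fun i => by positivity
    have hp' : ∀ i : Fin (d + 1), (0 : ℝ) < (i : ℕ) + 1 + if i = k then 1 else 0 := fun i => by
      split_ifs <;> positivity
    have e1 := key2 _ hp fun i j hij => by
      have : (i : ℕ) ≤ j := hij
      simpa using this
    have e2 := key2 _ hp' fun i j hij => by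
      rcases hij.eq_or_lt with rfl | hlt
      · exact le_rfl
      · have h1 : ((i : ℕ) : ℝ) + 1 ≤ (j : ℕ) := by exact_mod_cast hlt
        split_ifs <;> linarith
    have e3 : ∑ i, D i * (((i : ℕ) + 1 + if i = k then 1 else 0 : ℝ) : ℂ) =
        ∑ i, D i * (((i : ℕ) + 1 : ℝ) : ℂ) + D k := by
      simp only [Complex.ofReal_add, mul_add, Finset.sum_add_distrib]
      simp [apply_ite Complex.ofReal]
    rw [e3, e1, Finset.sum_add_distrib (g := fun i => if i = k then (1 : ℝ) else 0)] at e2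
    rw [Finset.sum_ite_eq' Finset.univ k] at e2
    simp only [Finset.mem_univ, if_true, Complex.ofReal_add, Complex.ofReal_one, mul_add,
      mul_one, add_right_inj] at e2
    linear_combination e2
  have hC : C = 0 := by
    simp only [hDC, Finset.sum_const, Finset.card_univ, Fintype.card_fin, nsmul_eq_mul,
      mul_eq_zero] at hD0
    exact hD0.resolve_left (by exact_mod_cast Nat.succ_ne_zero d)
  ext i
  exact sub_eq_zero.mp ((hDC i).trans hC)

/-- The space `C¹(Δ)` of complex-valued continuously differentiable functions on `Δ`, a function
`f` being recorded together with its (continuous) gradient `∇f`, which `f` determines (see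
`IsGradient.unique`). The norm is that of the `ℓ¹` product: `‖f‖_{C¹} = ‖f‖_∞ + ‖∇f‖_∞`, with the
Euclidean norm on gradients. -/
def c1Submodule (d : ℕ) :
    Submodule ℂ (WithLp 1 (C(Simplex d, ℂ) × C(Simplex d, EuclideanSpace ℂ (Fin (d + 1))))) where
  carrier := {p | IsGradient p.fst p.snd}
  zero_mem' w := by simp
  add_mem' {p q} hp hq w := by
    refine ⟨by simp [Finset.sum_add_distrib, (hp w).1, (hq w).1],
      ((hp w).2.add (hq w).2).congr_left fun z => ?_⟩
    simp only [WithLp.add_fst, WithLp.add_snd, ContinuousMap.add_apply, PiLp.add_apply, add_mul,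
      Finset.sum_add_distrib]
    ring
  smul_mem' c p hp w := by
    refine ⟨by simp [← Finset.mul_sum, (hp w).1],
      ((hp w).2.const_mul_left c).congr_left fun z => ?_⟩
    simp only [WithLp.smul_fst, WithLp.smul_snd, ContinuousMap.smul_apply, PiLp.smul_apply,
      smul_eq_mul, mul_assoc, ← Finset.mul_sum]
    ring

/-- The normed space `C¹(Δ)`. -/
abbrev C1 (d : ℕ) : Type := c1Submodule d

/-- The function underlying an element of `C¹(Δ)`. -/
def fn {d : ℕ} (f : C1 d) : C(Simplex d, ℂ) := f.1.fst

/-- The gradient of an element of `C¹(Δ)`. -/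
def grad {d : ℕ} (f : C1 d) : C(Simplex d, EuclideanSpace ℂ (Fin (d + 1))) := f.1.snd

theorem C1.norm_eq {d : ℕ} (f : C1 d) : ‖f‖ = ‖fn f‖ + ‖grad f‖ := by
  rw [Submodule.coe_norm, WithLp.prod_norm_eq_of_nat (p := 1) 1 (by simp)]
  simp [fn, grad]

/-- `μ` is an eigenvalue of `T` of (algebraic) multiplicity one: the eigenspace is a line, and the
whole space is the direct sum of the eigenspace and the range of `T - μ`. -/
def IsSimpleEigenvalue {E : Type*} [NormedAddCommGroup E] [NormedSpace ℂ E] (T : E →L[ℂ] E)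
    (μ : ℂ) : Prop :=
  Module.finrank ℂ (LinearMap.ker ((T : E →ₗ[ℂ] E) - μ • LinearMap.id)) = 1 ∧
    IsCompl (LinearMap.ker ((T : E →ₗ[ℂ] E) - μ • LinearMap.id))
      (LinearMap.range ((T : E →ₗ[ℂ] E) - μ • LinearMap.id))

/-- `T* ν = μ ν` for the dual `T*` of an operator `T` on `C⁰(Δ)`, where `ν` is viewed as the
functional `f ↦ ∫ f dν`. -/
def IsEigenmeasure {d : ℕ} (T : C(Simplex d, ℂ) →L[ℂ] C(Simplex d, ℂ)) (μ : ℝ)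
    (ν : MeasureTheory.ProbabilityMeasure (Simplex d)) : Prop :=
  ∀ f : C(Simplex d, ℂ), ∫ w, T f w ∂(ν : MeasureTheory.Measure (Simplex d)) =
    (μ : ℂ) * ∫ w, f w ∂(ν : MeasureTheory.Measure (Simplex d))

end

end MarkoffHurwitz

open MarkoffHurwitz

/-!
The proof contracts a cone of functions, with explicit constants; no theorem on quasi-compact
operators is needed.

On tuples with last entry `1`, the element `γ_{n-1}^A γ_j` has the last entry
`D = 1 + (A + 1) (1 - w_j)`. As `j ≤ n - 2`, the coordinate `w_j` is at most `1 / 2`, so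
`D ≥ (A + 3) / 2`: the weights `D ^ (-s)` are summable for `s > 1`, and every branch contracts the
`ℓ¹` norm of tangent vectors by `1 / D ≤ 2 / 3` (`l1_actDeriv_le`). Consider the cone `logCone d a`
of nonnegative functions whose logarithmic derivative is at most `a`. The transfer operator maps it
into `logCone d (2 s + 2 a / 3)` (`branchC1_mem_logCone`), so for `a = 12 s` into the smaller cone
with constant `10 s`. By the Harnack inequality on the cone, the image is uniformly inside: for
`f`, `g` in the cone, `ℒ f` dominates, in the order of the cone, a proportion `gapConst s` of the
multiple of `ℒ g` with the same value at a base point (`isConeContraction_transfer`).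

Such an operator on a Banach space (`IsConeContraction`) has a dominant eigenvalue, as in the
theorem of Perron and Frobenius. Iteration pinches `T^k f` between multiples of `T^k g` whose
coefficients approach each other at the rate `(1 - κ) ^ k`. This gives an eigenvector `h` in the
cone, a functional `p`, and the estimate `T^k = lam^k (p ⊗ h + O((1 - κ)^k))`; the spectral
statements follow from the deflated operator `T - lam p ⊗ h`
(`IsConeContraction.exists_simple_eigenvalue`). The cone generates `C¹(Δ)` because a large constant
plus any real function belongs to it.

The eigenmeasure is the limit of `f ↦ lam^(-k) (ℒ^k f)(w₀)`, which exists on the dense subspace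
`C¹(Δ)` and is bounded on `C⁰(Δ)` by comparison with `h` (`exists_eigenmeasure`). On `C¹(Δ)` every
eigenmeasure is proportional to `p`, hence its uniqueness. The constant `gapConst s` and the lower
bound `2 ^ (-s) / 11` of the eigenvalue are explicit and decreasing in `s`, so the gap is uniform
on compact intervals.
-/

namespace MarkoffHurwitz

/-! ### Operators contracting a cone -/

section ConeContraction

variable {E : Type*} [NormedAddCommGroup E] [NormedSpace ℝ E]

theorem tendsto_mul_pow_zero {r : ℝ} (hr : 0 ≤ r) (hr1 : r < 1) (b : ℝ) :
    Filter.Tendsto (fun k : ℕ => b * r ^ k) Filter.atTop (nhds 0) := by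
  simpa using (tendsto_pow_atTop_nhds_zero_of_lt_one hr hr1).const_mul b

/-- The operator `T` maps the closed convex cone `K` into itself, and uniformly inside: for `f, g ∈
K`, `T f` dominates a fixed proportion `κ` of the multiple of `T g` that has the same value under
`ρ`, in the order defined by `K`. The division by `ρ (T g)` is avoided by cross-multiplication. The
functional `ρ` controls the norm on `K`. -/
structure IsConeContraction (T : E →L[ℝ] E) (K : Set E) (ρ : E →L[ℝ] ℝ) (κ C : ℝ) : Prop where
  add_mem : ∀ {f g}, f ∈ K → g ∈ K → f + g ∈ K
  smul_mem : ∀ {c : ℝ} {f}, 0 ≤ c → f ∈ K → c • f ∈ K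
  isClosed : IsClosed K
  map_mem : ∀ {f}, f ∈ K → T f ∈ K
  pos : 0 < C
  norm_le : ∀ {f}, f ∈ K → ‖f‖ ≤ C * ρ f
  kappa_pos : 0 < κ
  kappa_le_one : κ ≤ 1
  contract : ∀ {f g}, f ∈ K → g ∈ K → ρ (T g) • T f - (κ * ρ (T f)) • T g ∈ K

namespace IsConeContraction

variable {T : E →L[ℝ] E} {K : Set E} {ρ : E →L[ℝ] ℝ} {κ C : ℝ}

theorem rho_nonneg (H : IsConeContraction T K ρ κ C) {f : E} (hf : f ∈ K) : 0 ≤ ρ f :=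
  nonneg_of_mul_nonneg_right ((norm_nonneg f).trans (H.norm_le hf)) H.pos

theorem iterate_mem (H : IsConeContraction T K ρ κ C) {f : E} (hf : f ∈ K) (k : ℕ) :
    T^[k] f ∈ K := by
  induction k with
  | zero => exact hf
  | succ k ih => rw [Function.iterate_succ_apply']; exact H.map_mem ih

/-- One step of the pinching: a lower bound `a` for `f` relative to `g` improves, after applying
`T`, to the convex combination of `a` and the quotient `ρ (T f) / ρ (T g)` with weight `κ` on the
latter. Upper bounds are lower bounds for `-f`. -/
theorem contract_step (H : IsConeContraction T K ρ κ C) {f g : E} {a : ℝ} (hg : g ∈ K)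
    (hρ : 0 < ρ (T g)) (hf : f - a • g ∈ K) :
    a ≤ ρ (T f) / ρ (T g) ∧
      T f - ((1 - κ) * a + κ * (ρ (T f) / ρ (T g))) • T g ∈ K := by
  have h1 := H.rho_nonneg (H.map_mem hf)
  simp only [map_sub, map_smul, smul_eq_mul] at h1
  refine ⟨by rw [le_div_iff₀ hρ]; linarith, ?_⟩
  have h2 := H.smul_mem (inv_nonneg.mpr hρ.le) (H.contract hf hg)
  convert h2 using 1
  simp only [map_sub, map_smul, smul_eq_mul, smul_sub, smul_smul]
  rw [inv_mul_cancel₀ hρ.ne', one_smul, sub_sub, ← add_smul]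
  congr 2
  field_simp
  ring

/-- If `a • g ≤ f ≤ b • g` in the order of the cone, then `T^k f` lies between multiples of `T^k g`
whose coefficients approach a common limit `c` at the rate `(1 - κ) ^ k`. -/
theorem exists_pinch (H : IsConeContraction T K ρ κ C) {f g : E} {a b : ℝ} (hg : g ∈ K)
    (hρ : ∀ k, 0 < ρ (T^[k] g)) (ha : f - a • g ∈ K) (hb : b • g - f ∈ K) :
    ∃ c, a ≤ c ∧ c ≤ b ∧ ∀ k,
      T^[k] f - (c - (b - a) * (1 - κ) ^ k) • T^[k] g ∈ K ∧
      (c + (b - a) * (1 - κ) ^ k) • T^[k] g - T^[k] f ∈ K := by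
  have hκ : 0 ≤ 1 - κ := by linarith [H.kappa_le_one]
  -- Starting from `a` or `b`, the coefficients move towards the same quotient `q` at each step, so
  -- their distance is multiplied by `1 - κ`.
  set q : ℕ → ℝ := fun k => ρ (T^[k] f) / ρ (T^[k] g) with hq
  let u : ℝ → ℕ → ℝ := fun x k => Nat.rec x (fun k y => (1 - κ) * y + κ * q (k + 1)) k
  have us : ∀ x k, u x (k + 1) = (1 - κ) * u x k + κ * q (k + 1) := fun _ _ => rfl
  have hdiff : ∀ k, u b k - u a k = (b - a) * (1 - κ) ^ k := by
    intro k
    induction k with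
    | zero => simp [u]
    | succ k ih => rw [us, us, pow_succ, ← mul_assoc, ← ih]; ring
  have hA : ∀ k, T^[k] f - u a k • T^[k] g ∈ K := by
    intro k
    induction k with
    | zero => exact ha
    | succ k ih =>
      have := (H.contract_step (H.iterate_mem hg k)
        (by simpa [Function.iterate_succ_apply'] using hρ (k + 1)) ih).2
      simpa only [us, hq, Function.iterate_succ_apply'] using this
  have hB : ∀ k, u b k • T^[k] g - T^[k] f ∈ K := by
    intro k
    induction k with
    | zero => exact hb
    | succ k ih =>
      have h0 : (-T^[k] f) - (-u b k) • T^[k] g ∈ K := by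
        convert ih using 1; module
      have := (H.contract_step (H.iterate_mem hg k)
        (by simpa [Function.iterate_succ_apply'] using hρ (k + 1)) h0).2
      convert this using 1
      simp only [us, hq, Function.iterate_succ_apply', map_neg, neg_div]
      module
  have hmA : Monotone (u a) := monotone_nat_of_le_succ fun k => by
    have := (H.contract_step (H.iterate_mem hg k)
        (by simpa [Function.iterate_succ_apply'] using hρ (k + 1)) (hA k)).1
    rw [← Function.iterate_succ_apply' T, ← Function.iterate_succ_apply' T] at this
    rw [us]; nlinarith [H.kappa_pos]
  have hmB : Antitone (u b) := antitone_nat_of_succ_le fun k => by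
    have h0 : (-T^[k] f) - (-u b k) • T^[k] g ∈ K := by
      convert hB k using 1; module
    have := (H.contract_step (H.iterate_mem hg k)
        (by simpa [Function.iterate_succ_apply'] using hρ (k + 1)) h0).1
    rw [map_neg, map_neg, neg_div, neg_le_neg_iff, ← Function.iterate_succ_apply' T,
      ← Function.iterate_succ_apply' T] at this
    rw [us]; nlinarith [H.kappa_pos]
  have hab : 0 ≤ b - a := by
    have h1 := H.rho_nonneg (H.add_mem ha hb)
    have h2 : f - a • g + (b • g - f) = (b - a) • g := by module
    rw [h2, map_smul, smul_eq_mul] at h1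
    exact nonneg_of_mul_nonneg_left h1 (hρ 0)
  have hle : ∀ i j, u a i ≤ u b j := fun i j => by
    have h1 := hmA (le_max_left i j)
    have h2 := hmB (le_max_right i j)
    have h3 := hdiff (max i j)
    have : 0 ≤ (b - a) * (1 - κ) ^ (max i j) := by positivity
    linarith
  have hbdd : BddAbove (Set.range (u a)) := ⟨u b 0, by rintro _ ⟨i, rfl⟩; exact hle i 0⟩
  refine ⟨⨆ k, u a k, le_ciSup hbdd 0, ciSup_le fun i => hle i 0, fun k => ?_⟩
  have h1 : u a k ≤ ⨆ k, u a k := le_ciSup hbdd k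
  have h2 : ⨆ k, u a k ≤ u b k := ciSup_le fun i => hle i k
  have hk := hdiff k
  have hgk := H.iterate_mem hg k
  constructor
  · have := H.add_mem (hA k) (H.smul_mem
      (c := u a k - ((⨆ k, u a k) - (b - a) * (1 - κ) ^ k)) (by linarith) hgk)
    convert this using 1; module
  · have := H.add_mem (hB k) (H.smul_mem
      (c := ((⨆ k, u a k) + (b - a) * (1 - κ) ^ k) - u b k) (by linarith) hgk)
    convert this using 1; module

/-- `exists_pinch` turned into a norm estimate, by means of the bound `‖f‖ ≤ C * ρ f` on the cone.
-/
theorem exists_norm_le (H : IsConeContraction T K ρ κ C) {f g : E} {a b : ℝ} (hg : g ∈ K)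
    (hρ : ∀ k, 0 < ρ (T^[k] g)) (ha : f - a • g ∈ K) (hb : b • g - f ∈ K) :
    ∃ c, a ≤ c ∧ c ≤ b ∧ ∀ k,
      ‖T^[k] f - c • T^[k] g‖ ≤
        (b - a) * (1 - κ) ^ k * ((2 * C * ‖ρ‖ + 1) * ‖T^[k] g‖) := by
  obtain ⟨c, hac, hcb, h⟩ := H.exists_pinch hg hρ ha hb
  refine ⟨c, hac, hcb, fun k => ?_⟩
  obtain ⟨h1, h2⟩ := h k
  have hκ : 0 ≤ 1 - κ := by linarith [H.kappa_le_one]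
  set ε := (b - a) * (1 - κ) ^ k
  have hε : 0 ≤ ε := mul_nonneg (by linarith) (pow_nonneg hκ k)
  have h3 := H.rho_nonneg h2
  have h4 := H.norm_le h1
  have h5 : ρ (T^[k] f - (c - ε) • T^[k] g) ≤ 2 * ε * ρ (T^[k] g) := by
    simp only [map_sub, map_smul, smul_eq_mul] at h3 ⊢
    linarith
  have h6 : ρ (T^[k] g) ≤ ‖ρ‖ * ‖T^[k] g‖ := (le_abs_self _).trans (ρ.le_opNorm _)
  calc ‖T^[k] f - c • T^[k] g‖ = ‖(T^[k] f - (c - ε) • T^[k] g) - ε • T^[k] g‖ := by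
        congr 1; module
    _ ≤ C * (2 * ε * (‖ρ‖ * ‖T^[k] g‖)) + ε * ‖T^[k] g‖ := by
        refine (norm_sub_le _ _).trans (add_le_add (h4.trans ?_) ?_)
        · have := H.pos
          gcongr
          exact h5.trans (by gcongr)
        · rw [norm_smul, Real.norm_of_nonneg hε]
    _ = _ := by ring

/-- The normalised iterates `T^k e / ρ (T^k e)` converge to an eigenvector in the cone, which
moreover dominates a positive multiple of `e`. -/
theorem exists_eigenvector [CompleteSpace E] (H : IsConeContraction T K ρ κ C) {e : E} {m M : ℝ}
    (he : e ∈ K) (he0 : e ≠ 0) (hm : 0 < m) (hl : T e - m • e ∈ K) (hu : M • e - T e ∈ K) :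
    ∃ (lam : ℝ) (h : E), m ≤ lam ∧ h ∈ K ∧ ρ h = 1 ∧ T h = lam • h ∧
      ∃ c : ℝ, 0 < c ∧ h - c • e ∈ K := by
  have hpos : ∀ f ∈ K, f ≠ 0 → 0 < ρ f := fun f hf h0 =>
    pos_of_mul_pos_right ((norm_pos_iff.mpr h0).trans_le (H.norm_le hf)) H.pos.le
  have hρ : ∀ k, 0 < ρ (T^[k] e) := by
    intro k
    have hk : ∀ k, T^[k + 1] e - m • T^[k] e ∈ K := by
      intro k
      induction k with
      | zero => exact hl
      | succ k ih =>
        have := H.map_mem ih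
        simpa only [map_sub, map_smul, ← Function.iterate_succ_apply' T] using this
    induction k with
    | zero => exact hpos e he he0
    | succ k ih =>
      have := H.rho_nonneg (hk k)
      rw [map_sub, map_smul, smul_eq_mul] at this
      nlinarith
  -- Pinching `T e` against `e` gives `T^(k+1) e ≈ lam • T^k e`: the iterates are asymptotically
  -- eigenvectors.
  obtain ⟨lam, hlam, -, hc⟩ := H.exists_norm_le he hρ hl hu
  have hlam0 : 0 < lam := hm.trans_le hlam
  have hκ : 0 ≤ 1 - κ := by linarith [H.kappa_le_one]
  have hMm : 0 ≤ M - m := by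
    have h1 := H.rho_nonneg (H.add_mem hl hu)
    have h2 : T e - m • e + (M • e - T e) = (M - m) • e := by module
    rw [h2, map_smul, smul_eq_mul] at h1
    exact nonneg_of_mul_nonneg_left h1 (hρ 0)
  set B := (M - m) * ((2 * C * ‖ρ‖ + 1) * C) with hB
  have hC := H.pos
  have hB0 : 0 ≤ B := by positivity
  set u : ℕ → E := fun k => (ρ (T^[k] e))⁻¹ • T^[k] e with hudef
  have huK : ∀ k, u k ∈ K := fun k => H.smul_mem (inv_nonneg.mpr (hρ k).le) (H.iterate_mem he k)
  have huρ : ∀ k, ρ (u k) = 1 := fun k => by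
    simp [hudef, inv_mul_cancel₀ (hρ k).ne']
  have hun : ∀ k, ‖u k‖ ≤ C := fun k => by simpa [huρ k] using H.norm_le (huK k)
  have hTu : ∀ k, ‖T (u k) - lam • u k‖ ≤ B * (1 - κ) ^ k := by
    intro k
    have h1 := hc k
    have h2 : T (u k) - lam • u k = (ρ (T^[k] e))⁻¹ • (T^[k] (T e) - lam • T^[k] e) := by
      simp only [hudef, map_smul, ← Function.iterate_succ_apply T k e,
        Function.iterate_succ_apply' T k e]
      module
    have h3 : ‖T^[k] e‖ ≤ C * ρ (T^[k] e) := H.norm_le (H.iterate_mem he k)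
    rw [h2, norm_smul, Real.norm_of_nonneg (inv_nonneg.mpr (hρ k).le),
      inv_mul_le_iff₀ (hρ k)]
    refine h1.trans ?_
    calc _ ≤ (M - m) * (1 - κ) ^ k * ((2 * C * ‖ρ‖ + 1) * (C * ρ (T^[k] e))) := by gcongr
      _ = _ := by rw [hB]; ring
  have hsucc : ∀ k, ρ (T (u k)) • u (k + 1) = T (u k) := by
    intro k
    have h1 := (hρ (k + 1)).ne'
    have h2 := (hρ k).ne'
    simp only [hudef, map_smul, ← Function.iterate_succ_apply' T k e, smul_eq_mul, smul_smul]
    congr 1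
    field_simp
  have hstep : ∀ k, dist (u k) (u (k + 1)) ≤ (lam⁻¹ * (B * (‖ρ‖ * C + 1))) * (1 - κ) ^ k := by
    intro k
    have h1 : lam • (u (k + 1) - u k) =
        (lam - ρ (T (u k))) • u (k + 1) + (T (u k) - lam • u k) := by
      nth_rewrite 2 [← hsucc k]; module
    have h2 : |lam - ρ (T (u k))| ≤ ‖ρ‖ * (B * (1 - κ) ^ k) := by
      have : lam - ρ (T (u k)) = - ρ (T (u k) - lam • u k) := by
        simp [huρ k]
      rw [this, abs_neg]
      exact (ρ.le_opNorm _).trans (by gcongr; exact hTu k)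
    rw [dist_comm, dist_eq_norm, mul_assoc, ← div_eq_inv_mul, le_div_iff₀ hlam0, mul_comm]
    calc lam * ‖u (k + 1) - u k‖ = ‖lam • (u (k + 1) - u k)‖ := by
          rw [norm_smul, Real.norm_of_nonneg hlam0.le]
      _ ≤ ‖ρ‖ * (B * (1 - κ) ^ k) * C + B * (1 - κ) ^ k := by
          rw [h1]
          refine (norm_add_le _ _).trans (add_le_add ?_ (hTu k))
          rw [norm_smul, Real.norm_eq_abs]
          gcongr
          exact hun _
      _ = _ := by ring
  have hκ1 : 1 - κ < 1 := by linarith [H.kappa_pos]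
  obtain ⟨h, hh⟩ := cauchySeq_tendsto_of_complete (cauchySeq_of_le_geometric _ _ hκ1 hstep)
  have hK : h ∈ K := H.isClosed.mem_of_tendsto hh (Filter.Eventually.of_forall huK)
  have hρh : ρ h = 1 := by
    refine tendsto_nhds_unique ((ρ.continuous.tendsto h).comp hh) ?_
    simp [Function.comp_def, huρ]
  have hTh : T h = lam • h := by
    rw [← sub_eq_zero]
    have h1 : Filter.Tendsto (fun k => T (u k) - lam • u k) Filter.atTop (nhds (T h - lam • h)) :=
      ((T.continuous.tendsto h).comp hh).sub (hh.const_smul lam)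
    refine tendsto_nhds_unique h1 (squeeze_zero_norm hTu (tendsto_mul_pow_zero hκ hκ1 B))
  refine ⟨lam, h, hlam, hK, hρh, hTh, κ * m / ρ (T e), ?_, ?_⟩
  · have := H.kappa_pos
    have : 0 < ρ (T e) := hρ 1
    positivity
  · have h1 : 0 < ρ (T e) := hρ 1
    have h2 := H.contract hK he
    rw [hTh, map_smul, hρh, smul_eq_mul, mul_one] at h2
    have h3 := H.add_mem h2 (H.smul_mem (mul_nonneg H.kappa_pos.le hlam0.le) hl)
    have h4 := H.smul_mem (inv_nonneg.mpr (mul_pos h1 hlam0).le) h3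
    convert h4 using 1
    match_scalars <;> field_simp
    ring

end IsConeContraction

end ConeContraction

/-! ### Spectral gap on a complex Banach space -/

section SpectralGap

variable {E : Type*} [NormedAddCommGroup E] [NormedSpace ℂ E]

theorem pow_apply_of_eigenvector {T : E →L[ℂ] E} {f : E} {a : ℂ} (hf : T f = a • f) (k : ℕ) :
    (T ^ k) f = a ^ k • f := by
  induction k with
  | zero => simp
  | succ k ih => rw [pow_succ', mul_apply_eq_comp, ih, map_smul, hf, smul_smul, pow_succ]

/-- If the cone generates `E` with control (`hgen`), then every orbit `T^k f` is exponentially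
close, relative to `lam ^ k`, to a multiple of `lam ^ k • h`. The constant `B` is uniform in `f`.
-/
theorem IsConeContraction.exists_decay [NormedSpace ℝ E] [IsScalarTower ℝ ℂ E] {T : E →L[ℂ] E}
    {K : Set E} {ρ : E →L[ℝ] ℝ} {κ C : ℝ}
    (H : IsConeContraction (T.restrictScalars ℝ) K ρ κ C) {h : E} {lam D : ℝ} (hK : h ∈ K)
    (hρ : ρ h = 1) (hT : T h = (lam : ℂ) • h) (hlam : 0 < lam)
    (hgen : ∀ f : E, ∃ f₁ f₂ : E, f = f₁ + Complex.I • f₂ ∧ (D * ‖f‖) • h + f₁ ∈ K ∧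
      (D * ‖f‖) • h - f₁ ∈ K ∧ (D * ‖f‖) • h + f₂ ∈ K ∧ (D * ‖f‖) • h - f₂ ∈ K) :
    ∃ B : ℝ, ∀ f : E, ∃ c : ℂ, ∀ k : ℕ,
      ‖(T ^ k) f - ((lam : ℂ) ^ k * c) • h‖ ≤ B * (lam * (1 - κ)) ^ k * ‖f‖ := by
  have hTk : ∀ k : ℕ, (T.restrictScalars ℝ)^[k] h = lam ^ k • h := by
    intro k
    induction k with
    | zero => simp
    | succ k ih =>
      rw [Function.iterate_succ_apply', ih, map_smul, ContinuousLinearMap.coe_restrictScalars', hT,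
        ← algebraMap_smul ℂ (lam ^ k), ← algebraMap_smul ℂ (lam ^ (k + 1)), smul_smul]
      simp [pow_succ]
  have hρk : ∀ k : ℕ, 0 < ρ ((T.restrictScalars ℝ)^[k] h) := fun k => by
    rw [hTk, map_smul, hρ, smul_eq_mul, mul_one]; positivity
  have hit : ∀ (k : ℕ) (f : E), (T.restrictScalars ℝ)^[k] f = (T ^ k) f := fun k f => by
    induction k with
    | zero => rfl
    | succ k ih => rw [Function.iterate_succ_apply', ih, pow_succ']; rfl
  refine ⟨4 * D * ((2 * C * ‖ρ‖ + 1) * ‖h‖), fun f => ?_⟩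
  obtain ⟨f₁, f₂, hf, h1, h2, h3, h4⟩ := hgen f
  obtain ⟨c₁, -, -, hc₁⟩ := H.exists_norm_le (f := f₁) (a := -(D * ‖f‖)) (b := D * ‖f‖) hK hρk
    (by convert h1 using 1; module) h2
  obtain ⟨c₂, -, -, hc₂⟩ := H.exists_norm_le (f := f₂) (a := -(D * ‖f‖)) (b := D * ‖f‖) hK hρk
    (by convert h3 using 1; module) h4
  refine ⟨c₁ + Complex.I * c₂, fun k => ?_⟩
  have e1 := hc₁ k
  have e2 := hc₂ k
  rw [hit, hTk, norm_smul, Real.norm_of_nonneg (by positivity)] at e1 e2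
  have hsplit : (T ^ k) f - ((lam : ℂ) ^ k * (c₁ + Complex.I * c₂)) • h =
      ((T ^ k) f₁ - c₁ • (lam ^ k • h)) + Complex.I • ((T ^ k) f₂ - c₂ • (lam ^ k • h)) := by
    conv_lhs => rw [hf]
    rw [map_add, map_smul]
    simp only [← algebraMap_smul ℂ (_ : ℝ) (_ : E), Complex.coe_algebraMap]
    push_cast
    module
  rw [hsplit]
  set x : ℝ := (D * ‖f‖ - -(D * ‖f‖)) * (1 - κ) ^ k * ((2 * C * ‖ρ‖ + 1) * (lam ^ k * ‖h‖))
  calc _ ≤ x + x := (norm_add_le _ _).trans (add_le_add e1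
        ((norm_smul Complex.I _).trans_le (by rw [Complex.norm_I, one_mul]; exact e2)))
    _ = _ := by simp only [x, mul_pow]; ring

/-- The limit coefficients in `IsConeContraction.exists_decay` are unique, hence define a
continuous functional `p`, and `T^k` converges to the rank one operator `p ⊗ h` after division by
`lam ^ k`. -/
theorem exists_functional_of_decay {T : E →L[ℂ] E} {h : E} {lam r B : ℝ} (hh : h ≠ 0)
    (hT : T h = (lam : ℂ) • h) (hlam : 0 < lam) (hr : 0 ≤ r) (hr1 : r < 1)
    (hdec : ∀ f : E, ∃ c : ℂ, ∀ k : ℕ,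
      ‖(T ^ k) f - ((lam : ℂ) ^ k * c) • h‖ ≤ B * (lam * r) ^ k * ‖f‖) :
    ∃ (p : E →L[ℂ] ℂ) (B' : ℝ), p h = 1 ∧ (∀ f, p (T f) = lam * p f) ∧
      ∀ k : ℕ, ‖T ^ k - (lam : ℂ) ^ k • p.smulRight h‖ ≤ B' * (lam * r) ^ k := by
  have hl0 : (lam : ℂ) ≠ 0 := by exact_mod_cast hlam.ne'
  have huniq : ∀ {f : E} {c c' : ℂ} {b b' : ℝ},
      (∀ k : ℕ, ‖(T ^ k) f - ((lam : ℂ) ^ k * c) • h‖ ≤ b * (lam * r) ^ k) →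
      (∀ k : ℕ, ‖(T ^ k) f - ((lam : ℂ) ^ k * c') • h‖ ≤ b' * (lam * r) ^ k) → c = c' := by
    intro f c c' b b' h1 h2
    have h3 : ∀ k : ℕ, ‖(c - c') • h‖ ≤ (b' + b) * r ^ k := by
      intro k
      have e : (lam : ℂ) ^ k • (c - c') • h = ((T ^ k) f - ((lam : ℂ) ^ k * c') • h) -
          ((T ^ k) f - ((lam : ℂ) ^ k * c) • h) := by module
      have h4 : lam ^ k * ‖(c - c') • h‖ ≤ lam ^ k * ((b' + b) * r ^ k) := by
        calc lam ^ k * ‖(c - c') • h‖ = ‖(lam : ℂ) ^ k • (c - c') • h‖ := by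
              rw [norm_smul ((lam : ℂ) ^ k), norm_pow, Complex.norm_real,
                Real.norm_of_nonneg hlam.le]
          _ ≤ b' * (lam * r) ^ k + b * (lam * r) ^ k := by
              rw [e]; exact (norm_sub_le _ _).trans (add_le_add (h2 k) (h1 k))
          _ = _ := by rw [mul_pow]; ring
      exact le_of_mul_le_mul_left h4 (by positivity)
    have h5 : ‖(c - c') • h‖ ≤ 0 := ge_of_tendsto' (tendsto_mul_pow_zero hr hr1 (b' + b)) h3
    have h6 := norm_le_zero_iff.mp h5
    exact sub_eq_zero.mp ((smul_eq_zero.mp h6).resolve_right hh)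
  choose c hc using hdec
  have hTk := pow_apply_of_eigenvector hT
  let p₀ : E →ₗ[ℂ] ℂ :=
    { toFun := c
      map_add' := fun f g => huniq (b := B * ‖f + g‖) (b' := B * ‖f‖ + B * ‖g‖)
        (fun k => (hc (f + g) k).trans_eq (by ring)) fun k => by
          have e : (T ^ k) (f + g) - ((lam : ℂ) ^ k * (c f + c g)) • h =
              ((T ^ k) f - ((lam : ℂ) ^ k * c f) • h) +
                ((T ^ k) g - ((lam : ℂ) ^ k * c g) • h) := by
            rw [map_add]; module
          rw [e]
          exact (norm_add_le _ _).trans ((add_le_add (hc f k) (hc g k)).trans_eq (by ring))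
      map_smul' := fun a f => huniq (b := B * ‖a • f‖) (b' := ‖a‖ * (B * ‖f‖))
        (fun k => (hc (a • f) k).trans_eq (by ring)) fun k => by
          have e : (T ^ k) (a • f) - ((lam : ℂ) ^ k * (a * c f)) • h =
              a • ((T ^ k) f - ((lam : ℂ) ^ k * c f) • h) := by
            rw [map_smul]; module
          simp only [RingHom.id_apply, smul_eq_mul]
          rw [e, norm_smul, mul_assoc]
          exact mul_le_mul_of_nonneg_left ((hc f k).trans_eq (by ring)) (norm_nonneg a) }
  have hp0 : ∀ f, p₀ f = c f := fun _ => rfl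
  have hhn : 0 < ‖h‖ := norm_pos_iff.mpr hh
  let p : E →L[ℂ] ℂ := p₀.mkContinuous ((1 + B) / ‖h‖) fun f => by
    have h0 := hc f 0
    simp only [pow_zero, one_mul, mul_one, one_apply_eq_self] at h0
    rw [hp0, div_mul_eq_mul_div, le_div_iff₀ hhn, ← norm_smul]
    calc ‖c f • h‖ = ‖f - (f - c f • h)‖ := by congr 1; abel
      _ ≤ ‖f‖ + B * ‖f‖ := (norm_sub_le _ _).trans (by gcongr)
      _ = _ := by ring
  have hp : ∀ f, p f = c f := fun _ => rfl
  refine ⟨p, max B 0, ?_, fun f => ?_, fun k => ?_⟩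
  · rw [hp]
    refine huniq (f := h) (b := B * ‖h‖) (b' := 0) (fun k => (hc h k).trans_eq (by ring))
      fun k => ?_
    simp [hTk]
  · rw [hp, hp]
    refine huniq (f := T f) (b := B * ‖T f‖) (b' := B * (lam * r) * ‖f‖)
      (fun k => (hc (T f) k).trans_eq (by ring)) fun k => ?_
    refine (le_of_eq ?_).trans ((hc f (k + 1)).trans_eq (by ring))
    rw [pow_succ T, mul_apply_eq_comp, pow_succ (lam : ℂ), mul_assoc]
  · refine ContinuousLinearMap.opNorm_le_bound _ (by positivity) fun f => ?_
    have : (T ^ k - (lam : ℂ) ^ k • p.smulRight h) f = (T ^ k) f - ((lam : ℂ) ^ k * c f) • h := by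
      simp [hp, smul_smul]
    rw [this]
    exact (hc f k).trans (by gcongr; exact le_max_left _ _)

/-- The spectral radius is at most `ρ` if `‖a ^ k‖ = O(ρ ^ k)`. The case `k = 0` is left out of the
hypothesis, since the bound is applied to an operator whose powers have the required form only for
`k > 0`. -/
theorem norm_le_of_mem_spectrum_of_pow_le {A : Type*} [NormedRing A] [NormedAlgebra ℂ A]
    [CompleteSpace A] {a : A} {B ρ : ℝ} (hρ : 0 ≤ ρ)
    (h : ∀ k : ℕ, 0 < k → ‖a ^ k‖ ≤ B * ρ ^ k) {z : ℂ}
    (hz : z ∈ spectrum ℂ a) : ‖z‖ ≤ ρ := by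
  by_contra! hlt
  have hz0 : 0 < ‖z‖ := hρ.trans_lt hlt
  have h1 : ∀ k : ℕ, 1 ≤ (B * ‖(1 : A)‖) * (ρ / ‖z‖) ^ (k + 1) := by
    intro k
    have h2 := spectrum.norm_le_norm_mul_of_mem (spectrum.pow_mem_pow a (k + 1) hz)
    rw [norm_pow] at h2
    have h3 : ‖z‖ ^ (k + 1) ≤ B * ρ ^ (k + 1) * ‖(1 : A)‖ :=
      h2.trans (mul_le_mul_of_nonneg_right (h _ k.succ_pos) (norm_nonneg _))
    rw [div_pow, mul_div_assoc', le_div_iff₀ (by positivity)]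
    linarith
  have h2 : Filter.Tendsto (fun k : ℕ => (B * ‖(1 : A)‖) * (ρ / ‖z‖) ^ (k + 1)) Filter.atTop
      (nhds 0) := by
    have := (tendsto_pow_atTop_nhds_zero_of_lt_one (r := ρ / ‖z‖) (by positivity)
      ((div_lt_one hz0).mpr hlt)).comp (Filter.tendsto_add_atTop_nat 1)
    simpa [Function.comp_def] using this.const_mul (B * ‖(1 : A)‖)
  exact absurd (ge_of_tendsto' h2 h1) (by norm_num)

section RankOne

variable {T : E →L[ℂ] E} {h : E} {p : E →L[ℂ] ℂ} {lam r B : ℝ}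

/-- The powers of the deflated operator `T - lam • p ⊗ h` are `T^k - lam^k • p ⊗ h` for `k > 0`, so
its spectral radius is at most `lam * r`. -/
theorem spectrum_sub_rankOne [CompleteSpace E] (hT : T h = (lam : ℂ) • h) (hlam : 0 < lam)
    (hr : 0 ≤ r) (hp : p h = 1) (hpT : ∀ f, p (T f) = lam * p f)
    (hdec : ∀ k : ℕ, ‖T ^ k - (lam : ℂ) ^ k • p.smulRight h‖ ≤ B * (lam * r) ^ k) {z : ℂ}
    (hz : z ∈ spectrum ℂ (T - (lam : ℂ) • p.smulRight h)) : ‖z‖ ≤ lam * r := by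
  refine norm_le_of_mem_spectrum_of_pow_le (B := B) (by positivity) (fun k hk => ?_) hz
  have : (T - (lam : ℂ) • p.smulRight h) ^ k = T ^ k - (lam : ℂ) ^ k • p.smulRight h := by
    induction k, hk using Nat.le_induction with
    | base => simp
    | succ k hk ih =>
      have hTk := pow_apply_of_eigenvector hT
      rw [pow_succ, ih, pow_succ]
      ext f
      simp only [mul_apply_eq_comp, sub_apply, smul_apply,
        ContinuousLinearMap.smulRight_apply, map_sub, map_smul, hpT, hp, hTk, pow_succ]
      module
  rw [this]
  exact hdec k

theorem spectrum_diff_subset [CompleteSpace E] (hT : T h = (lam : ℂ) • h) (hlam : 0 < lam)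
    (hr : 0 ≤ r) (hp : p h = 1) (hpT : ∀ f, p (T f) = lam * p f)
    (hdec : ∀ k : ℕ, ‖T ^ k - (lam : ℂ) ^ k • p.smulRight h‖ ≤ B * (lam * r) ^ k) :
    spectrum ℂ T \ {(lam : ℂ)} ⊆ Metric.closedBall 0 (lam * r) := by
  rintro z ⟨hz, hzl⟩
  rw [mem_closedBall_zero_iff]
  by_contra! hlt
  refine hz ?_
  have hz0 : z ≠ 0 := norm_pos_iff.mp ((by positivity : (0:ℝ) ≤ lam * r).trans_lt hlt)
  have hzl' : z - lam ≠ 0 := sub_ne_zero.mpr hzl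
  have h1 : IsUnit (algebraMap ℂ (E →L[ℂ] E) z - (T - (lam : ℂ) • p.smulRight h)) := by
    by_contra hn
    exact absurd (spectrum_sub_rankOne hT hlam hr hp hpT hdec hn) (not_le.mpr hlt)
  have h2 : IsUnit (1 - ((lam : ℂ) / z) • p.smulRight h : E →L[ℂ] E) := by
    rw [isUnit_iff_exists]
    refine ⟨1 + ((lam : ℂ) / (z - lam)) • p.smulRight h, ?_, ?_⟩ <;>
    · ext f
      simp only [mul_apply_eq_comp, sub_apply, add_apply,
        smul_apply, ContinuousLinearMap.smulRight_apply,
        one_apply_eq_self, map_sub, map_add, map_smul, hp]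
      match_scalars <;> field_simp
      ring
  -- Off the point `lam`, the resolvent of `T` is that of the deflated operator up to the rank one
  -- factor of `h2`.
  have h3 : algebraMap ℂ (E →L[ℂ] E) z - T =
      (algebraMap ℂ (E →L[ℂ] E) z - (T - (lam : ℂ) • p.smulRight h)) *
        (1 - ((lam : ℂ) / z) • p.smulRight h) := by
    ext f
    simp only [mul_apply_eq_comp, sub_apply, Algebra.algebraMap_eq_smul_one,
        smul_apply, ContinuousLinearMap.smulRight_apply,
        one_apply_eq_self, map_sub, map_smul, hp, hT]
    match_scalars <;> field_simp
    ring
  exact (congrArg IsUnit h3).mpr (h1.mul h2)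

theorem eigenvector_eq (hlam : 0 < lam) (hr : 0 ≤ r) (hr1 : r < 1)
    (hdec : ∀ k : ℕ, ‖T ^ k - (lam : ℂ) ^ k • p.smulRight h‖ ≤ B * (lam * r) ^ k) {f : E}
    (hf : T f = (lam : ℂ) • f) : f = p f • h := by
  have hTk := pow_apply_of_eigenvector hf
  have h1 : ∀ k : ℕ, ‖f - p f • h‖ ≤ (B * ‖f‖) * r ^ k := by
    intro k
    have h2 := (ContinuousLinearMap.le_opNorm _ f).trans
      (mul_le_mul_of_nonneg_right (hdec k) (norm_nonneg f))
    have h3 : (T ^ k - (lam : ℂ) ^ k • p.smulRight h) f = (lam : ℂ) ^ k • (f - p f • h) := by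
      simp [hTk, smul_sub]
    rw [h3, norm_smul, norm_pow, Complex.norm_real, Real.norm_of_nonneg hlam.le] at h2
    refine le_of_mul_le_mul_left (h2.trans_eq ?_) (pow_pos hlam k)
    rw [mul_pow]; ring
  have h2 : ‖f - p f • h‖ ≤ 0 := ge_of_tendsto' (tendsto_mul_pow_zero hr hr1 (B * ‖f‖)) h1
  exact sub_eq_zero.mp (norm_le_zero_iff.mp h2)

theorem isSimpleEigenvalue [CompleteSpace E] (hT : T h = (lam : ℂ) • h) (hlam : 0 < lam)
    (hr : 0 ≤ r) (hr1 : r < 1) (hp : p h = 1) (hpT : ∀ f, p (T f) = lam * p f)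
    (hdec : ∀ k : ℕ, ‖T ^ k - (lam : ℂ) ^ k • p.smulRight h‖ ≤ B * (lam * r) ^ k) :
    IsSimpleEigenvalue T lam := by
  have hl0 : (lam : ℂ) ≠ 0 := by exact_mod_cast hlam.ne'
  have hh : h ≠ 0 := by rintro rfl; simp at hp
  have hmem : ∀ f, f ∈ LinearMap.ker ((T : E →ₗ[ℂ] E) - (lam : ℂ) • LinearMap.id) ↔
      T f = (lam : ℂ) • f := fun f => by
    simp [LinearMap.mem_ker, sub_eq_zero]
  have hker : LinearMap.ker ((T : E →ₗ[ℂ] E) - (lam : ℂ) • LinearMap.id) = ℂ ∙ h := by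
    ext f
    rw [hmem, Submodule.mem_span_singleton]
    constructor
    · exact fun hf => ⟨p f, (eigenvector_eq hlam hr hr1 hdec hf).symm⟩
    · rintro ⟨c, rfl⟩
      rw [map_smul, hT, smul_comm]
  refine ⟨by rw [hker]; exact finrank_span_singleton hh, ?_, ?_⟩
  · rw [Submodule.disjoint_def]
    rintro f hf ⟨g, rfl⟩
    have h1 := eigenvector_eq hlam hr hr1 hdec ((hmem _).mp hf)
    rw [h1]
    simp [hpT]
  · rw [codisjoint_iff_le_sup]
    intro f _
    rw [hker]
    -- The point `lam` is in the resolvent set of the deflated operator, which agrees with `T` on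
    -- the kernel of `p`: the inverse solves `(T - lam) g = f - p f • h`.
    have h1 : IsUnit (algebraMap ℂ (E →L[ℂ] E) lam - (T - (lam : ℂ) • p.smulRight h)) := by
      by_contra hn
      have := spectrum_sub_rankOne hT hlam hr hp hpT hdec hn
      rw [Complex.norm_real, Real.norm_of_nonneg hlam.le] at this
      nlinarith
    obtain ⟨S, hS, -⟩ := isUnit_iff_exists.mp h1
    set g₀ := f - p f • h with hg₀
    have hpg : p g₀ = 0 := by simp [hg₀, hp]
    have h2 : (lam : ℂ) • S g₀ - T (S g₀) + ((lam : ℂ) * p (S g₀)) • h = g₀ := by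
      have := congrArg (fun A : E →L[ℂ] E => A g₀) hS
      simp only [mul_apply_eq_comp, sub_apply, Algebra.algebraMap_eq_smul_one,
        smul_apply, ContinuousLinearMap.smulRight_apply,
        one_apply_eq_self] at this
      refine Eq.trans ?_ this
      module
    have h3 : (lam : ℂ) * p (S g₀) = 0 := by
      have := congrArg p h2
      simpa [hpT, hp, hpg] using this
    rw [h3, zero_smul, add_zero] at h2
    refine Submodule.mem_sup.mpr ⟨p f • h, Submodule.smul_mem _ _
      (Submodule.mem_span_singleton_self h), g₀, ⟨-S g₀, ?_⟩, by simp [hg₀]⟩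
    refine Eq.trans ?_ h2
    simp
    abel

end RankOne

/-- Perron–Frobenius theorem for a cone contraction with a generating cone: the eigenvector `h` and
the functional `p` of the leading eigenvalue `lam`, with convergence of `lam^(-k) • T^k` to `p ⊗
h`. -/
theorem IsConeContraction.exists_spectral_gap [CompleteSpace E] [NormedSpace ℝ E]
    [IsScalarTower ℝ ℂ E] {T : E →L[ℂ] E} {K : Set E} {ρ : E →L[ℝ] ℝ} {κ C : ℝ}
    (H : IsConeContraction (T.restrictScalars ℝ) K ρ κ C) {e : E} {m M D : ℝ} (he : e ∈ K)
    (he0 : e ≠ 0) (hm : 0 < m) (hl : T e - m • e ∈ K) (hu : M • e - T e ∈ K)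
    (hgen : ∀ f : E, ∃ f₁ f₂ : E, f = f₁ + Complex.I • f₂ ∧ (D * ‖f‖) • e + f₁ ∈ K ∧
      (D * ‖f‖) • e - f₁ ∈ K ∧ (D * ‖f‖) • e + f₂ ∈ K ∧ (D * ‖f‖) • e - f₂ ∈ K) :
    ∃ (lam c B : ℝ) (h : E) (p : E →L[ℂ] ℂ), m ≤ lam ∧ 0 < c ∧ h ∈ K ∧ ρ h = 1 ∧ h - c • e ∈ K ∧
      T h = (lam : ℂ) • h ∧ p h = 1 ∧ (∀ f, p (T f) = lam * p f) ∧
      ∀ k : ℕ, ‖T ^ k - (lam : ℂ) ^ k • p.smulRight h‖ ≤ B * (lam * (1 - κ)) ^ k := by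
  obtain ⟨lam, h, hlam, hK, hρ, hTh, c, hc, hce⟩ := H.exists_eigenvector he he0 hm hl hu
  have hlam0 := hm.trans_le hlam
  have hT : T h = (lam : ℂ) • h := by
    have : (lam : ℂ) • h = lam • h := algebraMap_smul ℂ lam h
    rw [this]; exact hTh
  -- Since `h` dominates `c • e`, the cone is generated from `h` as it is from `e`, with a worse
  -- constant.
  have hadd : ∀ (g : E) (t : ℝ), 0 ≤ t → (t • e + g ∈ K) → ((t / c) • h + g ∈ K) := by
    intro g t ht hg
    have := H.add_mem (H.smul_mem (div_nonneg ht hc.le) hce) hg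
    convert this using 1
    match_scalars <;> field_simp
    ring
  have hD : ∀ f : E, 0 ≤ D * ‖f‖ := by
    intro f
    obtain ⟨f₁, f₂, -, h1, h2, -, -⟩ := hgen f
    have h3 := H.rho_nonneg (H.add_mem h1 h2)
    have h4 : (D * ‖f‖) • e + f₁ + ((D * ‖f‖) • e - f₁) = (2 * (D * ‖f‖)) • e := by module
    rw [h4, map_smul, smul_eq_mul] at h3
    have h5 : 0 < ρ e := pos_of_mul_pos_right
      ((norm_pos_iff.mpr he0).trans_le (H.norm_le he)) H.pos.le
    linarith [nonneg_of_mul_nonneg_left h3 h5]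
  obtain ⟨B, hB⟩ := H.exists_decay (D := D / c) hK hρ hT hlam0 fun f => by
    obtain ⟨f₁, f₂, hf, h1, h2, h3, h4⟩ := hgen f
    rw [sub_eq_add_neg] at h2 h4
    refine ⟨f₁, f₂, hf, ?_⟩
    rw [sub_eq_add_neg, sub_eq_add_neg, div_mul_eq_mul_div]
    exact ⟨hadd _ _ (hD f) h1, hadd _ _ (hD f) h2, hadd _ _ (hD f) h3,
      hadd _ _ (hD f) h4⟩
  have hh : h ≠ 0 := by rintro rfl; simp at hρ
  obtain ⟨p, B', hp, hpT, hdec⟩ := exists_functional_of_decay hh hT hlam0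
    (by linarith [H.kappa_le_one]) (by linarith [H.kappa_pos]) hB
  exact ⟨lam, c, B', h, p, hlam, hc, hK, hρ, hce, hT, hp, hpT, hdec⟩

/-- The spectral form of `IsConeContraction.exists_spectral_gap`. The decay is stated on orbits,
where only the norm of `E` enters. -/
theorem IsConeContraction.exists_simple_eigenvalue [CompleteSpace E] [NormedSpace ℝ E]
    [IsScalarTower ℝ ℂ E] {T : E →L[ℂ] E} {K : Set E} {ρ : E →L[ℝ] ℝ} {κ C : ℝ}
    (H : IsConeContraction (T.restrictScalars ℝ) K ρ κ C) {e : E} {m M D : ℝ} (he : e ∈ K)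
    (he0 : e ≠ 0) (hm : 0 < m) (hl : T e - m • e ∈ K) (hu : M • e - T e ∈ K)
    (hgen : ∀ f : E, ∃ f₁ f₂ : E, f = f₁ + Complex.I • f₂ ∧ (D * ‖f‖) • e + f₁ ∈ K ∧
      (D * ‖f‖) • e - f₁ ∈ K ∧ (D * ‖f‖) • e + f₂ ∈ K ∧ (D * ‖f‖) • e - f₂ ∈ K) :
    ∃ (lam c B : ℝ) (h : E) (p : E → ℂ), m ≤ lam ∧ 0 < c ∧ h ∈ K ∧ h - c • e ∈ K ∧
      T h = (lam : ℂ) • h ∧ IsSimpleEigenvalue T lam ∧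
      spectrum ℂ T \ {(lam : ℂ)} ⊆ Metric.closedBall 0 (lam * (1 - κ)) ∧
      (∀ f, T f = (lam : ℂ) • f → f = p f • h) ∧
      ∀ (f : E) (k : ℕ), ‖T^[k] f - ((lam : ℂ) ^ k * p f) • h‖ ≤
        B * (lam * (1 - κ)) ^ k * ‖f‖ := by
  obtain ⟨lam, c, B, h, p, hlam, hc, hK, -, hce, hT, hp, hpT, hdec⟩ :=
    H.exists_spectral_gap he he0 hm hl hu hgen
  have hlam0 := hm.trans_le hlam
  have hr : 0 ≤ 1 - κ := by linarith [H.kappa_le_one]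
  have hr1 : 1 - κ < 1 := by linarith [H.kappa_pos]
  refine ⟨lam, c, B, h, p, hlam, hc, hK, hce, hT, isSimpleEigenvalue hT hlam0 hr hr1 hp hpT hdec,
    spectrum_diff_subset hT hlam0 hr hp hpT hdec, fun f hf => eigenvector_eq hlam0 hr hr1 hdec hf,
    fun f k => ?_⟩
  have h1 : (T ^ k - (lam : ℂ) ^ k • p.smulRight h) f =
      T^[k] f - ((lam : ℂ) ^ k * p f) • h := by
    have h2 : (T ^ k) f = T^[k] f := by
      induction k generalizing f with
      | zero => rfl
      | succ k ih => rw [pow_succ, mul_apply_eq_comp, ih, Function.iterate_succ_apply]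
    rw [← h2, mul_smul]
    rfl
  rw [← h1]
  exact (ContinuousLinearMap.le_opNorm _ f).trans
    (mul_le_mul_of_nonneg_right (hdec k) (norm_nonneg f))

end SpectralGap

/-! ### Derivatives on the simplex -/

section Calculus

open Filter Topology

variable {d : ℕ}

/-- The linear form `v ↦ ∑ i, G i * v i` on real vectors defined by a complex gradient `G`. -/
noncomputable def pairing (G : EuclideanSpace ℂ (Fin (d + 1))) :
    EuclideanSpace ℝ (Fin (d + 1)) →L[ℝ] ℂ :=
  ∑ i, G i • Complex.ofRealCLM.comp (EuclideanSpace.proj i)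

theorem pairing_apply (G : EuclideanSpace ℂ (Fin (d + 1))) (v : EuclideanSpace ℝ (Fin (d + 1))) :
    pairing G v = ∑ i, G i * (v i : ℂ) := by
  simp [pairing]

theorem pairing_add (G G' : EuclideanSpace ℂ (Fin (d + 1))) :
    pairing (G + G') = pairing G + pairing G' := by
  ext v; simp [pairing_apply, add_mul, Finset.sum_add_distrib]

theorem pairing_sub (G G' : EuclideanSpace ℂ (Fin (d + 1))) :
    pairing (G - G') = pairing G - pairing G' := by
  ext v; simp [pairing_apply, sub_mul, Finset.sum_sub_distrib]

theorem pairing_smul (c : ℂ) (G : EuclideanSpace ℂ (Fin (d + 1))) :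
    pairing (c • G) = c • pairing G := by
  simp [pairing, smul_smul, Finset.smul_sum]

theorem continuous_pairing :
    Continuous (pairing : EuclideanSpace ℂ (Fin (d + 1)) → _) := by
  unfold pairing
  fun_prop

/-- The `ℓ¹` norm, for which the branches of the system contract with the uniform factor `2 / 3`;
the norm of `EuclideanSpace` is the Euclidean one. -/
def l1 (v : EuclideanSpace ℝ (Fin (d + 1))) : ℝ := ∑ i, |v i|

theorem l1_nonneg (v : EuclideanSpace ℝ (Fin (d + 1))) : 0 ≤ l1 v :=
  Finset.sum_nonneg fun _ _ => abs_nonneg _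

theorem norm_pairing_apply_le_l1 (G : EuclideanSpace ℂ (Fin (d + 1)))
    (v : EuclideanSpace ℝ (Fin (d + 1))) : ‖pairing G v‖ ≤ ‖G‖ * l1 v := by
  rw [pairing_apply, l1, Finset.mul_sum]
  refine (norm_sum_le _ _).trans (Finset.sum_le_sum fun i _ => ?_)
  rw [norm_mul, Complex.norm_real, Real.norm_eq_abs]
  exact mul_le_mul_of_nonneg_right (PiLp.norm_apply_le G i) (abs_nonneg _)

theorem l1_le (v : EuclideanSpace ℝ (Fin (d + 1))) : l1 v ≤ (d + 1) * ‖v‖ := by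
  calc l1 v ≤ ∑ _i : Fin (d + 1), ‖v‖ := Finset.sum_le_sum fun i _ => PiLp.norm_apply_le v i
    _ = _ := by simp

theorem norm_pairing_le (G : EuclideanSpace ℂ (Fin (d + 1))) : ‖pairing G‖ ≤ (d + 1) * ‖G‖ :=
  ContinuousLinearMap.opNorm_le_bound _ (by positivity) fun v =>
    (norm_pairing_apply_le_l1 G v).trans (by nlinarith [l1_le v, norm_nonneg G])

/-- The vector tangent to the hyperplane `∑ w_i = const` that represents the linear form `φ` on
tangent vectors. -/
noncomputable def tangentVec (φ : EuclideanSpace ℝ (Fin (d + 1)) →L[ℝ] ℂ) :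
    EuclideanSpace ℂ (Fin (d + 1)) :=
  WithLp.toLp 2 fun i => φ (EuclideanSpace.single i 1) -
    (∑ k, φ (EuclideanSpace.single k 1)) / (d + 1)

theorem tangentVec_apply (φ : EuclideanSpace ℝ (Fin (d + 1)) →L[ℝ] ℂ) (i : Fin (d + 1)) :
    tangentVec φ i = φ (EuclideanSpace.single i 1) -
      (∑ k, φ (EuclideanSpace.single k 1)) / (d + 1) := rfl

theorem sum_tangentVec (φ : EuclideanSpace ℝ (Fin (d + 1)) →L[ℝ] ℂ) :
    ∑ i, tangentVec φ i = 0 := by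
  have : (d + 1 : ℂ) ≠ 0 := by exact_mod_cast d.succ_ne_zero
  simp only [tangentVec_apply, Finset.sum_sub_distrib, Finset.sum_const, Finset.card_univ,
    Fintype.card_fin, nsmul_eq_mul]
  push_cast
  field_simp
  ring

theorem pairing_tangentVec (φ : EuclideanSpace ℝ (Fin (d + 1)) →L[ℝ] ℂ)
    {v : EuclideanSpace ℝ (Fin (d + 1))} (hv : ∑ i, v i = 0) :
    pairing (tangentVec φ) v = φ v := by
  have h1 : φ v = ∑ i, φ (EuclideanSpace.single i 1) * (v i : ℂ) := by
    have : v = ∑ i, v i • EuclideanSpace.single i (1 : ℝ) := by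
      ext k; simp [Pi.single_apply]
    conv_lhs => rw [this]
    simp [map_sum, mul_comm]
  have h2 : ∑ i, (v i : ℂ) = 0 := by exact_mod_cast hv
  simp only [pairing_apply, tangentVec_apply, sub_mul, Finset.sum_sub_distrib, ← Finset.mul_sum,
    h2, h1, mul_zero, sub_zero]

theorem continuous_tangentVec :
    Continuous (tangentVec : (EuclideanSpace ℝ (Fin (d + 1)) →L[ℝ] ℂ) → _) := by
  unfold tangentVec
  fun_prop

theorem norm_le_sum_norm (G : EuclideanSpace ℂ (Fin (d + 1))) : ‖G‖ ≤ ∑ i, ‖G i‖ := by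
  have : G = ∑ i, EuclideanSpace.single i (G i) := by
    ext k; simp
  conv_lhs => rw [this]
  exact (norm_sum_le _ _).trans (by simp)

theorem norm_tangentVec_le (φ : EuclideanSpace ℝ (Fin (d + 1)) →L[ℝ] ℂ) :
    ‖tangentVec φ‖ ≤ 2 * (d + 1) * ‖φ‖ := by
  have h1 : ∀ i, ‖φ (EuclideanSpace.single i 1)‖ ≤ ‖φ‖ := fun i => by
    simpa using φ.le_opNorm (EuclideanSpace.single i 1)
  have h0 : (0 : ℝ) < d + 1 := by positivity
  have h2 : ‖(∑ k, φ (EuclideanSpace.single k 1)) / ((d : ℂ) + 1)‖ ≤ ‖φ‖ := by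
    have : ‖((d : ℂ) + 1)‖ = d + 1 := by
      rw [show ((d : ℂ) + 1) = ((d + 1 : ℝ) : ℂ) by push_cast; rfl, Complex.norm_real,
        Real.norm_of_nonneg h0.le]
    rw [norm_div, this, div_le_iff₀ h0]
    calc _ ≤ ∑ _k : Fin (d + 1), ‖φ‖ := (norm_sum_le _ _).trans (Finset.sum_le_sum fun i _ => h1 i)
      _ = _ := by simp [mul_comm]
  calc _ ≤ ∑ _i : Fin (d + 1), (‖φ‖ + ‖φ‖) := (norm_le_sum_norm _).trans
        (Finset.sum_le_sum fun i _ => (norm_sub_le _ _).trans (add_le_add (h1 i) h2))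
    _ = _ := by simp; ring

/-- The extension by zero of a function on `Δ` to the ambient space. -/
noncomputable def extendZero (f : Simplex d → ℂ) : EuclideanSpace ℝ (Fin (d + 1)) → ℂ :=
  Function.extend Subtype.val f 0

@[simp] theorem extendZero_coe (f : Simplex d → ℂ) (w : Simplex d) : extendZero f w.1 = f w :=
  Subtype.val_injective.extend_apply f 0 w

theorem sum_sub_eq_zero (z w : Simplex d) : ∑ i, (z.1 - w.1) i = 0 := by
  simp [Finset.sum_sub_distrib, z.2.2.2, w.2.2.2]

theorem hasFDerivWithinAt_iff_isLittleO_simplex {F : EuclideanSpace ℝ (Fin (d + 1)) → ℂ}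
    {F' : EuclideanSpace ℝ (Fin (d + 1)) →L[ℝ] ℂ} {w : Simplex d} :
    HasFDerivWithinAt F F' (simplex d) w.1 ↔
      (fun z : Simplex d => F z.1 - F w.1 - F' (z.1 - w.1)) =o[𝓝 w] fun z => z.1 - w.1 := by
  rw [hasFDerivWithinAt_iff_isLittleO, nhdsWithin_eq_map_subtype_coe w.2, Asymptotics.isLittleO_map]
  rfl

/-- A derivative within `simplex d` in the sense of Mathlib yields a gradient, by projection to the
tangent space. -/
theorem isGradient_tangentVec {f : Simplex d → ℂ} {F : EuclideanSpace ℝ (Fin (d + 1)) → ℂ}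
    {F' : Simplex d → EuclideanSpace ℝ (Fin (d + 1)) →L[ℝ] ℂ} (hf : ∀ w : Simplex d, F w.1 = f w)
    (h : ∀ w, HasFDerivWithinAt F (F' w) (simplex d) w.1) :
    IsGradient f fun w => tangentVec (F' w) := by
  intro w
  refine ⟨sum_tangentVec _, ?_⟩
  refine (hasFDerivWithinAt_iff_isLittleO_simplex.mp (h w)).congr_left fun z => ?_
  rw [hf, hf, ← pairing_tangentVec _ (sum_sub_eq_zero z w), pairing_apply]
  simp

theorem IsGradient.hasFDerivWithinAt {f : Simplex d → ℂ}
    {G : Simplex d → EuclideanSpace ℂ (Fin (d + 1))} (h : IsGradient f G) (w : Simplex d) :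
    HasFDerivWithinAt (extendZero f) (pairing (G w)) (simplex d) w.1 := by
  rw [hasFDerivWithinAt_iff_isLittleO_simplex]
  refine (h w).2.congr_left fun z => ?_
  rw [extendZero_coe, extendZero_coe, pairing_apply]
  simp

theorem convex_simplex : Convex ℝ (simplex d) := by
  intro x hx y hy a b ha hb hab
  refine ⟨fun i => ?_, fun i j hij => ?_, ?_⟩
  · have := mul_nonneg ha (hx.1 i)
    have := mul_nonneg hb (hy.1 i)
    simp; linarith
  · have := mul_le_mul_of_nonneg_left (hx.2.1 i j hij) ha
    have := mul_le_mul_of_nonneg_left (hy.2.1 i j hij) hb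
    simp; linarith
  · simp [Finset.sum_add_distrib, ← Finset.mul_sum, hx.2.2, hy.2.2, hab]

/-- Mean value inequality: the error of the linear approximation at `w` is controlled by the
oscillation `η` of the gradient. The factor `d + 1` compares `‖pairing G‖` with `‖G‖`. -/
theorem IsGradient.norm_sub_sub_le {f : Simplex d → ℂ}
    {G : Simplex d → EuclideanSpace ℂ (Fin (d + 1))} (h : IsGradient f G) {w z : Simplex d} {η : ℝ}
    (hη : ∀ x : Simplex d, dist x w ≤ dist z w → ‖G x - G w‖ ≤ η) :
    ‖f z - f w - pairing (G w) (z.1 - w.1)‖ ≤ (d + 1) * η * ‖z.1 - w.1‖ := by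
  classical
  set S := simplex d ∩ Metric.closedBall w.1 (dist z w) with hS
  have h1 := Convex.norm_image_sub_le_of_norm_hasFDerivWithin_le' (f := extendZero f)
    (f' := fun x => if hx : x ∈ simplex d then pairing (G ⟨x, hx⟩) else 0) (s := S)
    (C := (d + 1) * η) (φ := pairing (G w)) (x := w.1) (y := z.1)
    (fun x hx => by
      rw [dif_pos hx.1]
      exact (h.hasFDerivWithinAt ⟨x, hx.1⟩).mono Set.inter_subset_left)
    (fun x hx => by
      rw [dif_pos hx.1, ← pairing_sub]
      refine (norm_pairing_le _).trans ?_
      have := hη ⟨x, hx.1⟩ hx.2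
      gcongr)
    (convex_simplex.inter (convex_closedBall _ _))
    ⟨w.2, Metric.mem_closedBall_self dist_nonneg⟩ ⟨z.2, le_refl (dist z w)⟩
  simpa using h1

/-- Gradients pass to uniform limits, by the mean value inequality on the convex intersections of
`Δ` with balls. -/
theorem isGradient_of_tendsto {f : ℕ → C(Simplex d, ℂ)}
    {G : ℕ → C(Simplex d, EuclideanSpace ℂ (Fin (d + 1)))} {f₀ : C(Simplex d, ℂ)}
    {G₀ : C(Simplex d, EuclideanSpace ℂ (Fin (d + 1)))} (h : ∀ k, IsGradient (f k) (G k))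
    (hf : Tendsto f atTop (𝓝 f₀)) (hG : Tendsto G atTop (𝓝 G₀)) : IsGradient f₀ G₀ := by
  have hfw : ∀ w, Tendsto (fun k => f k w) atTop (𝓝 (f₀ w)) := fun w =>
    ((ContinuousMap.evalCLM ℂ w).continuous.tendsto f₀).comp hf
  have hGw : ∀ w, Tendsto (fun k => G k w) atTop (𝓝 (G₀ w)) := fun w =>
    ((ContinuousMap.evalCLM ℂ w).continuous.tendsto G₀).comp hG
  intro w
  constructor
  · have h1 : Tendsto (fun k => ∑ i, G k w i) atTop (𝓝 (∑ i, G₀ w i)) :=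
      tendsto_finsetSum _ fun i _ =>
        ((EuclideanSpace.proj (𝕜 := ℂ) i).continuous.tendsto _).comp (hGw w)
    refine tendsto_nhds_unique h1 ?_
    simp [fun k => (h k w).1]
  · rw [Asymptotics.isLittleO_iff]
    intro c hc
    have hd : (0 : ℝ) < d + 1 := by positivity
    obtain ⟨δ, hδ, hδ'⟩ := Metric.continuousAt_iff.mp (G₀.continuous.continuousAt (x := w))
      (c / (d + 1)) (by positivity)
    filter_upwards [Metric.ball_mem_nhds w hδ] with z hz
    have h1 : ∀ k, ‖f k z - f k w - pairing (G k w) (z.1 - w.1)‖ ≤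
        (d + 1) * (c / (d + 1) + 2 * ‖G k - G₀‖) * ‖z.1 - w.1‖ := by
      intro k
      refine (h k).norm_sub_sub_le fun x hx => ?_
      have e1 : ‖G₀ x - G₀ w‖ ≤ c / (d + 1) := by
        rw [← dist_eq_norm]; exact (hδ' (hx.trans_lt hz)).le
      have e2 := (G k - G₀).norm_coe_le_norm x
      have e3 := (G k - G₀).norm_coe_le_norm w
      calc ‖G k x - G k w‖ = ‖(G₀ x - G₀ w) + ((G k - G₀) x - (G k - G₀) w)‖ := by
            congr 1; simp; abel
        _ ≤ c / (d + 1) + (‖G k - G₀‖ + ‖G k - G₀‖) :=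
            (norm_add_le _ _).trans (add_le_add e1 ((norm_sub_le _ _).trans (add_le_add e2 e3)))
        _ = _ := by ring
    have h2 : Tendsto (fun k => ‖f k z - f k w - pairing (G k w) (z.1 - w.1)‖) atTop
        (𝓝 ‖f₀ z - f₀ w - pairing (G₀ w) (z.1 - w.1)‖) := by
      refine (((hfw z).sub (hfw w)).sub ?_).norm
      exact (((continuous_pairing (d := d)).clm_apply continuous_const).tendsto (G₀ w)).comp (hGw w)
    have h3 : Tendsto (fun k => (d + 1) * (c / (d + 1) + 2 * ‖G k - G₀‖) * ‖z.1 - w.1‖) atTop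
        (𝓝 ((d + 1) * (c / (d + 1) + 2 * 0) * ‖z.1 - w.1‖)) := by
      refine Tendsto.mul_const _ (Tendsto.const_mul _ (Tendsto.const_add _
        (Tendsto.const_mul _ ?_)))
      exact tendsto_iff_norm_sub_tendsto_zero.mp hG
    have h4 := le_of_tendsto_of_tendsto' h2 h3 h1
    rw [pairing_apply] at h4
    refine (le_of_eq ?_).trans (h4.trans_eq (by field_simp; ring))
    simp

/-- `C¹(Δ)` is a closed subspace of `C⁰ × C⁰`, hence a Banach space. -/
instance instCompleteSpaceC1 : CompleteSpace (C1 d) := by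
  refine IsClosed.completeSpace_coe (hs := ?_)
  refine IsSeqClosed.isClosed fun p q hp hq => ?_
  have h1 : Continuous fun x : WithLp 1
      (C(Simplex d, ℂ) × C(Simplex d, EuclideanSpace ℂ (Fin (d + 1)))) => WithLp.ofLp x :=
    WithLp.prod_continuous_ofLp 1 _ _
  have h2 := (h1.tendsto q).comp hq
  exact isGradient_of_tendsto hp ((continuous_fst.tendsto _).comp h2)
    ((continuous_snd.tendsto _).comp h2)

end Calculus

/-! ### The algebra `C¹(Δ)` and its density in `C⁰(Δ)` -/

section FunctionSpace

open Filter Topology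

variable {d : ℕ}

theorem C1.isGradient (f : C1 d) : IsGradient (fn f) (grad f) := f.2

theorem C1.ext_fn {f g : C1 d} (h : fn f = fn g) : f = g := by
  have h2 : (grad f : Simplex d → _) = grad g := f.isGradient.unique (by rw [h]; exact g.isGradient)
  apply Subtype.ext
  apply (WithLp.equiv 1 _).injective
  exact Prod.ext h (DFunLike.coe_injective h2)

@[simp] theorem fn_add (f g : C1 d) : fn (f + g) = fn f + fn g := rfl
@[simp] theorem fn_sub (f g : C1 d) : fn (f - g) = fn f - fn g := rfl
@[simp] theorem fn_smul (c : ℂ) (f : C1 d) : fn (c • f) = c • fn f := rfl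
@[simp] theorem fn_real_smul (c : ℝ) (f : C1 d) : fn (c • f) = c • fn f := rfl
@[simp] theorem grad_add (f g : C1 d) : grad (f + g) = grad f + grad g := rfl
@[simp] theorem grad_sub (f g : C1 d) : grad (f - g) = grad f - grad g := rfl
@[simp] theorem grad_smul (c : ℂ) (f : C1 d) : grad (c • f) = c • grad f := rfl
@[simp] theorem grad_real_smul (c : ℝ) (f : C1 d) : grad (c • f) = c • grad f := rfl

/-- The inclusion of `C¹(Δ)` into `C⁰(Δ)`. -/
noncomputable def fnL : C1 d →L[ℂ] C(Simplex d, ℂ) :=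
  LinearMap.mkContinuous
    { toFun := fn, map_add' := fn_add, map_smul' := fn_smul } 1 fun f =>
      (le_add_of_nonneg_right (norm_nonneg (grad f))).trans_eq
        ((C1.norm_eq f).symm.trans (one_mul _).symm)

@[simp] theorem fnL_apply (f : C1 d) : fnL f = fn f := rfl

theorem norm_fn_apply_le (f : C1 d) (w : Simplex d) : ‖fn f w‖ ≤ ‖fn f‖ :=
  (fn f).norm_coe_le_norm w

theorem norm_grad_apply_le (f : C1 d) (w : Simplex d) : ‖grad f w‖ ≤ ‖grad f‖ :=
  (grad f).norm_coe_le_norm w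

/-- The element of `C¹(Δ)` given by a function `f`, an extension `F` of it to the ambient space,
and a continuous family of derivatives of `F` within `Δ`. -/
noncomputable def C1.mk' (f : C(Simplex d, ℂ)) (F : EuclideanSpace ℝ (Fin (d + 1)) → ℂ)
    (F' : C(Simplex d, EuclideanSpace ℝ (Fin (d + 1)) →L[ℝ] ℂ)) (hf : ∀ w : Simplex d, F w.1 = f w)
    (h : ∀ w, HasFDerivWithinAt F (F' w) (simplex d) w.1) : C1 d :=
  ⟨WithLp.toLp 1 (f, ⟨fun w => tangentVec (F' w), continuous_tangentVec.comp F'.continuous⟩),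
    isGradient_tangentVec hf h⟩

section mk'

variable {f : C(Simplex d, ℂ)} {F : EuclideanSpace ℝ (Fin (d + 1)) → ℂ}
  {F' : C(Simplex d, EuclideanSpace ℝ (Fin (d + 1)) →L[ℝ] ℂ)} {hf : ∀ w : Simplex d, F w.1 = f w}
  {h : ∀ w, HasFDerivWithinAt F (F' w) (simplex d) w.1}

@[simp] theorem C1.fn_mk' : fn (C1.mk' f F F' hf h) = f := rfl

theorem C1.pairing_grad_mk' (w : Simplex d) {v : EuclideanSpace ℝ (Fin (d + 1))}
    (hv : ∑ i, v i = 0) : pairing (grad (C1.mk' f F F' hf h) w) v = F' w v :=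
  pairing_tangentVec _ hv

end mk'

/-- The constant functions. -/
noncomputable def C1.const (c : ℂ) : C1 d :=
  C1.mk' (ContinuousMap.const _ c) (fun _ => c) 0 (fun _ => rfl)
    fun w => hasFDerivWithinAt_const c w.1 (simplex d)

@[simp] theorem C1.fn_const (c : ℂ) : fn (C1.const c : C1 d) = ContinuousMap.const _ c := rfl

theorem C1.pairing_grad_const (c : ℂ) (w : Simplex d) {v : EuclideanSpace ℝ (Fin (d + 1))}
    (hv : ∑ i, v i = 0) : pairing (grad (C1.const c) w) v = 0 := by
  exact (C1.pairing_grad_mk' w hv).trans rfl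

/-- The complex conjugate of a function. -/
noncomputable def C1.conj (f : C1 d) : C1 d :=
  C1.mk' (star (fn f)) (fun x => Complex.conjCLE (extendZero (fn f) x))
    ⟨fun w => (Complex.conjCLE : ℂ →L[ℝ] ℂ).comp (pairing (grad f w)),
      continuous_const.clm_comp (continuous_pairing.comp (grad f).continuous)⟩
    (fun w => by simp)
    fun w => (Complex.conjCLE : ℂ →L[ℝ] ℂ).hasFDerivAt.comp_hasFDerivWithinAt w.1
      (f.isGradient.hasFDerivWithinAt w)

@[simp] theorem C1.fn_conj (f : C1 d) : fn f.conj = star (fn f) := rfl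

/-- The pointwise product of two functions. -/
noncomputable def C1.mul (f g : C1 d) : C1 d :=
  C1.mk' (fn f * fn g) (fun x => extendZero (fn f) x * extendZero (fn g) x)
    ⟨fun w => fn f w • pairing (grad g w) + fn g w • pairing (grad f w),
      ((fn f).continuous.smul (continuous_pairing.comp (grad g).continuous)).add
        ((fn g).continuous.smul (continuous_pairing.comp (grad f).continuous))⟩
    (fun w => by simp)
    fun w => by
      have := (f.isGradient.hasFDerivWithinAt w).mul (g.isGradient.hasFDerivWithinAt w)
      simp only [extendZero_coe] at this
      exact this

@[simp] theorem C1.fn_mul (f g : C1 d) : fn (f.mul g) = fn f * fn g := rfl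

/-- The coordinate function `w ↦ w_i`. -/
noncomputable def C1.coord (i : Fin (d + 1)) : C1 d :=
  C1.mk' ⟨fun w => (w.1 i : ℂ), by fun_prop⟩
    (Complex.ofRealCLM.comp (EuclideanSpace.proj i : EuclideanSpace ℝ (Fin (d + 1)) →L[ℝ] ℝ))
    (ContinuousMap.const _ (Complex.ofRealCLM.comp (EuclideanSpace.proj i)))
    (fun w => rfl)
    fun w => (Complex.ofRealCLM.comp (EuclideanSpace.proj i :
      EuclideanSpace ℝ (Fin (d + 1)) →L[ℝ] ℝ)).hasFDerivWithinAt

@[simp] theorem C1.fn_coord (i : Fin (d + 1)) (w : Simplex d) : fn (C1.coord i) w = (w.1 i : ℂ) :=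
  rfl

/-- By the Stone–Weierstrass theorem, `C¹(Δ)` is dense in `C⁰(Δ)`. -/
theorem denseRange_fnL : DenseRange (fnL : C1 d → C(Simplex d, ℂ)) := by
  let A : StarSubalgebra ℂ C(Simplex d, ℂ) :=
    { carrier := Set.range (fnL : C1 d → C(Simplex d, ℂ))
      mul_mem' := by rintro _ _ ⟨f, rfl⟩ ⟨g, rfl⟩; exact ⟨f.mul g, rfl⟩
      add_mem' := by rintro _ _ ⟨f, rfl⟩ ⟨g, rfl⟩; exact ⟨f + g, rfl⟩
      algebraMap_mem' := fun c => ⟨C1.const c, by ext; simp [Algebra.algebraMap_eq_smul_one]⟩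
      star_mem' := by rintro _ ⟨f, rfl⟩; exact ⟨f.conj, rfl⟩ }
  have hA : A.SeparatesPoints := by
    intro x y hxy
    obtain ⟨i, hi⟩ : ∃ i, x.1 i ≠ y.1 i := by
      by_contra! h
      exact hxy (Subtype.ext (PiLp.ext h))
    refine ⟨fn (C1.coord i), ⟨_, ⟨C1.coord i, rfl⟩, rfl⟩, ?_⟩
    simpa using hi
  have h1 := ContinuousMap.starSubalgebra_topologicalClosure_eq_top_of_separatesPoints A hA
  intro f
  have h2 : f ∈ A.topologicalClosure := by rw [h1]; trivial
  exact h2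

end FunctionSpace

/-! ### The cone of functions with bounded logarithmic derivative -/

section Cone

open Filter Topology

variable {d : ℕ}

/-- The cone of nonnegative `C¹` functions with `|∂_v f| ≤ a ‖v‖₁ f` for tangent vectors `v`. A
nonzero element is positive everywhere by `harnack`, and `log f` is then `a`-Lipschitz for the `ℓ¹`
distance. -/
def logCone (d : ℕ) (a : ℝ) : Set (C1 d) :=
  {f | ∀ w, (fn f w).im = 0 ∧ 0 ≤ (fn f w).re ∧
    ∀ v : EuclideanSpace ℝ (Fin (d + 1)), ∑ i, v i = 0 →
      ‖pairing (grad f w) v‖ ≤ a * l1 v * (fn f w).re}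

variable {a b : ℝ}

theorem logCone_mono (hab : a ≤ b) : logCone d a ⊆ logCone d b := fun f hf w =>
  ⟨(hf w).1, (hf w).2.1, fun v hv => ((hf w).2.2 v hv).trans (by
    have := (hf w).2.1
    have := l1_nonneg v
    gcongr)⟩

theorem add_mem_logCone {f g : C1 d} (hf : f ∈ logCone d a) (hg : g ∈ logCone d a) :
    f + g ∈ logCone d a := by
  intro w
  obtain ⟨f1, f2, f3⟩ := hf w
  obtain ⟨g1, g2, g3⟩ := hg w
  refine ⟨by simp [f1, g1], by simpa using add_nonneg f2 g2, fun v hv => ?_⟩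
  have : pairing (grad (f + g) w) v = pairing (grad f w) v + pairing (grad g w) v := by
    simp [pairing_add]
  rw [this]
  refine (norm_add_le _ _).trans ((add_le_add (f3 v hv) (g3 v hv)).trans_eq ?_)
  simp; ring

theorem smul_mem_logCone {c : ℝ} {f : C1 d} (hc : 0 ≤ c) (hf : f ∈ logCone d a) :
    c • f ∈ logCone d a := by
  intro w
  obtain ⟨f1, f2, f3⟩ := hf w
  refine ⟨by simp [f1], by simpa using mul_nonneg hc f2, fun v hv => ?_⟩
  have : pairing (grad (c • f) w) v = c * pairing (grad f w) v := by
    have : grad (c • f) w = (c : ℂ) • grad f w := by simp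
    rw [this, pairing_smul]; simp
  rw [this, norm_mul, Complex.norm_real, Real.norm_of_nonneg hc]
  refine (mul_le_mul_of_nonneg_left (f3 v hv) hc).trans_eq ?_
  simp; ring

theorem continuous_fn_apply (w : Simplex d) : Continuous fun f : C1 d => fn f w :=
  (ContinuousMap.evalCLM ℂ w).continuous.comp fnL.continuous

theorem continuous_grad_apply (w : Simplex d) : Continuous fun f : C1 d => grad f w := by
  have h1 : Continuous fun x : C1 d => WithLp.ofLp x.1 :=
    (WithLp.prod_continuous_ofLp 1 _ _).comp continuous_subtype_val
  exact (ContinuousMap.evalCLM ℂ w).continuous.comp (continuous_snd.comp h1)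

theorem isClosed_logCone : IsClosed (logCone d a) := by
  have : logCone d a = ⋂ w, ({f : C1 d | (fn f w).im = 0} ∩ ({f | 0 ≤ (fn f w).re} ∩
      ⋂ v : EuclideanSpace ℝ (Fin (d + 1)), ⋂ _ : ∑ i, v i = 0,
        {f | ‖pairing (grad f w) v‖ ≤ a * l1 v * (fn f w).re})) := by
    ext f; simp [logCone]
  rw [this]
  have hre : ∀ w, Continuous fun f : C1 d => (fn f w).re := fun w =>
    Complex.continuous_re.comp (continuous_fn_apply w)
  have him : ∀ w, Continuous fun f : C1 d => (fn f w).im := fun w =>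
    Complex.continuous_im.comp (continuous_fn_apply w)
  refine isClosed_iInter fun w => (isClosed_eq (him w) continuous_const).inter
    ((isClosed_le continuous_const (hre w)).inter (isClosed_iInter fun v => isClosed_iInter fun _ =>
      isClosed_le ?_ (continuous_const.mul (hre w))))
  exact ((continuous_pairing.comp (continuous_grad_apply w)).clm_apply continuous_const).norm

/-- The simplex has `ℓ¹` diameter at most `2`. -/
theorem l1_sub_le (w z : Simplex d) : l1 (w.1 - z.1) ≤ 2 := by
  calc l1 (w.1 - z.1) ≤ ∑ i, (w.1 i + z.1 i) := Finset.sum_le_sum fun i _ => by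
        rw [PiLp.sub_apply]
        exact (abs_sub _ _).trans_eq (by rw [abs_of_nonneg (w.2.1 i), abs_of_nonneg (z.2.1 i)])
    _ = 2 := by rw [Finset.sum_add_distrib, w.2.2.2, z.2.2.2]; norm_num

theorem norm_fn_of_mem {f : C1 d} (hf : f ∈ logCone d a) (w : Simplex d) :
    ‖fn f w‖ = (fn f w).re := by
  have : fn f w = ((fn f w).re : ℂ) := Complex.ext rfl (by simp [(hf w).1])
  rw [this, Complex.norm_real, Complex.ofReal_re, Real.norm_of_nonneg (hf w).2.1]

/-- Grönwall's inequality along the segment from `w` to `z`, whose `ℓ¹` length is at most `2`. -/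
theorem harnack {f : C1 d} (ha : 0 ≤ a) (hf : f ∈ logCone d a) (w z : Simplex d) :
    (fn f z).re ≤ Real.exp (2 * a) * (fn f w).re := by
  have hmem : ∀ t ∈ Set.Icc (0 : ℝ) 1, w.1 + t • (z.1 - w.1) ∈ simplex d := fun t ht => by
    have := convex_simplex w.2 z.2 (sub_nonneg.mpr ht.2) ht.1 (by ring)
    convert this using 1; module
  have hγ : ∀ t : ℝ, HasDerivWithinAt (fun t : ℝ => w.1 + t • (z.1 - w.1)) (z.1 - w.1)
      (Set.Icc 0 1) t := fun t => by
    simpa using (((hasDerivAt_id t).smul_const (z.1 - w.1)).const_add w.1).hasDerivWithinAt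
  have hD : ∀ (t : ℝ) (ht : t ∈ Set.Icc (0 : ℝ) 1),
      HasDerivWithinAt (fun t : ℝ => extendZero (fn f) (w.1 + t • (z.1 - w.1)))
        (pairing (grad f ⟨_, hmem t ht⟩) (z.1 - w.1)) (Set.Icc 0 1) t := fun t ht =>
    (f.isGradient.hasFDerivWithinAt ⟨_, hmem t ht⟩).comp_hasDerivWithinAt t (hγ t) hmem
  classical
  have h1 := norm_le_gronwallBound_of_norm_deriv_right_le
    (f := fun t : ℝ => extendZero (fn f) (w.1 + t • (z.1 - w.1)))
    (f' := fun t => if ht : t ∈ Set.Icc (0 : ℝ) 1 then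
      pairing (grad f ⟨_, hmem t ht⟩) (z.1 - w.1) else 0)
    (δ := (fn f w).re) (K := 2 * a) (ε := 0) (a := 0) (b := 1)
    (fun t ht => (hD t ht).continuousWithinAt)
    (fun t ht => by
      have ht' : t ∈ Set.Icc (0 : ℝ) 1 := Set.Ico_subset_Icc_self ht
      rw [dif_pos ht']
      exact (hD t ht').mono_of_mem_nhdsWithin (Icc_mem_nhdsGE_of_mem ht))
    (by simp [norm_fn_of_mem hf])
    (fun t ht => by
      have ht' : t ∈ Set.Icc (0 : ℝ) 1 := Set.Ico_subset_Icc_self ht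
      have h2 := extendZero_coe (fn f) ⟨_, hmem t ht'⟩
      rw [dif_pos ht', add_zero, h2, norm_fn_of_mem hf]
      refine ((hf _).2.2 _ (sum_sub_eq_zero z w)).trans ?_
      have := l1_sub_le z w
      have := (hf ⟨_, hmem t ht'⟩).2.1
      have : a * l1 (z.1 - w.1) ≤ 2 * a := by nlinarith
      gcongr)
    1 (Set.right_mem_Icc.mpr zero_le_one)
  rw [gronwallBound_ε0] at h1
  have h2 : w.1 + (1 : ℝ) • (z.1 - w.1) = z.1 := by module
  rw [h2, extendZero_coe, norm_fn_of_mem hf] at h1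
  simpa [mul_comm] using h1

theorem norm_le_of_mem_logCone {f : C1 d} (ha : 0 ≤ a) (hf : f ∈ logCone d a) (w : Simplex d) :
    ‖f‖ ≤ (1 + 2 * a * (d + 1)) * Real.exp (2 * a) * (fn f w).re := by
  have hw := (hf w).2.1
  have h1 : ‖fn f‖ ≤ Real.exp (2 * a) * (fn f w).re := by
    rw [ContinuousMap.norm_le _ (by positivity)]
    exact fun z => by rw [norm_fn_of_mem hf]; exact harnack ha hf w z
  have h2 : ‖grad f‖ ≤ 2 * a * (d + 1) * (Real.exp (2 * a) * (fn f w).re) := by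
    rw [ContinuousMap.norm_le _ (by positivity)]
    intro z
    have hz := (hf z).2.1
    have hd : (0 : ℝ) < d + 1 := by positivity
    have h3 : ∀ i, ‖grad f z i‖ ≤ 2 * a * (fn f z).re := by
      intro i
      -- Since the gradient is tangent, its `i`-th entry is its pairing with the tangential part `v`
      -- of the `i`-th basis vector, and `v` has `ℓ¹` norm at most `2`.
      set v : EuclideanSpace ℝ (Fin (d + 1)) := WithLp.toLp 2 fun k =>
        (if k = i then 1 else 0) - 1 / (d + 1 : ℝ) with hv
      have hv0 : ∑ k, v k = 0 := by
        simp [hv, Finset.sum_sub_distrib]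
        field_simp
        ring
      have hv1 : l1 v ≤ 2 := by
        calc l1 v ≤ ∑ k : Fin (d + 1), ((if k = i then 1 else 0) + 1 / (d + 1 : ℝ)) :=
              Finset.sum_le_sum fun k _ => by
                refine (abs_sub _ _).trans_eq ?_
                rw [abs_of_nonneg (by split_ifs <;> norm_num), abs_of_nonneg (by positivity)]
          _ = 2 := by
            simp [Finset.sum_add_distrib]
            field_simp
            ring
      have h4 : pairing (grad f z) v = grad f z i := by
        have h5 := (f.isGradient z).1
        simp only [pairing_apply, hv, Complex.ofReal_sub, mul_sub, Finset.sum_sub_distrib,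
          ← Finset.sum_mul, h5]
        simp [apply_ite Complex.ofReal]
      rw [← h4]
      refine ((hf z).2.2 v hv0).trans ?_
      have : a * l1 v ≤ 2 * a := by nlinarith
      gcongr
    calc ‖grad f z‖ ≤ ∑ _i : Fin (d + 1), 2 * a * (fn f z).re :=
          (norm_le_sum_norm _).trans (Finset.sum_le_sum fun i _ => h3 i)
      _ = 2 * a * (d + 1) * (fn f z).re := by simp; ring
      _ ≤ _ := by gcongr; exact harnack ha hf w z
  rw [C1.norm_eq]
  linarith

/-- A criterion for `f - g` to stay in the larger cone `logCone d a` when `f` and `g` lie in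
`logCone d b` with `b < a`: it suffices that `f` exceeds `g` by the factor `(a + b) / (a - b)`. -/
theorem sub_mem_logCone {f g : C1 d} (hb : b < a) (hb0 : 0 ≤ b)
    (hf : f ∈ logCone d b) (hg : g ∈ logCone d b)
    (h : ∀ w, (a + b) * (fn g w).re ≤ (a - b) * (fn f w).re) : f - g ∈ logCone d a := by
  intro w
  obtain ⟨f1, f2, f3⟩ := hf w
  obtain ⟨g1, g2, g3⟩ := hg w
  have hw := h w
  refine ⟨by simp [f1, g1], ?_, fun v hv => ?_⟩
  · have : (fn g w).re ≤ (fn f w).re := by nlinarith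
    simpa using this
  · have : pairing (grad (f - g) w) v = pairing (grad f w) v - pairing (grad g w) v := by
      simp [pairing_sub]
    rw [this]
    refine (norm_sub_le _ _).trans ((add_le_add (f3 v hv) (g3 v hv)).trans ?_)
    have := l1_nonneg v
    have h2 : b * (fn f w).re + b * (fn g w).re ≤ a * ((fn f w).re - (fn g w).re) := by linarith
    simp only [fn_sub, ContinuousMap.sub_apply, Complex.sub_re]
    nlinarith

theorem const_mem_logCone {c : ℝ} (hc : 0 ≤ c) (ha : 0 ≤ a) :
    (C1.const (c : ℂ) : C1 d) ∈ logCone d a := by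
  intro w
  refine ⟨by simp, by simpa using hc, fun v hv => ?_⟩
  rw [C1.pairing_grad_const _ _ hv, norm_zero]
  have := l1_nonneg v
  simp
  positivity

theorem const_add_mem_logCone {f : C1 d} {c : ℝ} (ha : 1 ≤ a) (hc : 2 * ‖f‖ ≤ c)
    (him : ∀ w, (fn f w).im = 0) : C1.const (c : ℂ) + f ∈ logCone d a := by
  intro w
  have h1 : ‖fn f w‖ ≤ ‖f‖ := (norm_fn_apply_le f w).trans (by
    rw [C1.norm_eq]; exact le_add_of_nonneg_right (norm_nonneg _))
  have h2 : ‖grad f w‖ ≤ ‖f‖ := (norm_grad_apply_le f w).trans (by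
    rw [C1.norm_eq]; exact le_add_of_nonneg_left (norm_nonneg _))
  have h3 := (abs_le.mp ((Complex.abs_re_le_norm _).trans h1)).1
  have h0 := norm_nonneg f
  have h4 : ‖f‖ ≤ (fn (C1.const (c : ℂ) + f) w).re := by
    rw [fn_add, ContinuousMap.add_apply, C1.fn_const, ContinuousMap.const_apply, Complex.add_re,
      Complex.ofReal_re]
    linarith
  refine ⟨by simp [him], h0.trans h4, fun v hv => ?_⟩
  have : pairing (grad (C1.const (c : ℂ) + f) w) v = pairing (grad f w) v := by
    simp [pairing_add, C1.pairing_grad_const _ _ hv]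
  rw [this]
  have hl := l1_nonneg v
  calc _ ≤ ‖grad f w‖ * l1 v := norm_pairing_apply_le_l1 _ _
    _ ≤ (fn (C1.const (c : ℂ) + f) w).re * (a * l1 v) := by
      gcongr
      · exact h0.trans h4
      · exact h2.trans h4
      · exact le_mul_of_one_le_left hl ha
    _ = _ := by ring

/-- Up to a constant factor, conjugation is bounded on `C¹(Δ)`; the factor comes from the
projection of the conjugate derivative to the tangent space. -/
theorem C1.norm_conj_le (f : C1 d) : ‖f.conj‖ ≤ 2 * (d + 1) ^ 2 * ‖f‖ := by
  have h1 : ‖fn f.conj‖ = ‖fn f‖ := norm_star _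
  have h2 : ‖grad f.conj‖ ≤ 2 * (d + 1) ^ 2 * ‖grad f‖ := by
    rw [ContinuousMap.norm_le _ (by positivity)]
    intro w
    refine (norm_tangentVec_le _).trans ?_
    have : ‖(Complex.conjCLE : ℂ →L[ℝ] ℂ).comp (pairing (grad f w))‖ ≤ (d + 1) * ‖grad f‖ := by
      refine ContinuousLinearMap.opNorm_le_bound _ (by positivity) fun v => ?_
      have h3 : ‖(Complex.conjCLE : ℂ →L[ℝ] ℂ).comp (pairing (grad f w)) v‖ =
          ‖pairing (grad f w) v‖ :=
        Complex.norm_conj _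
      rw [h3]
      refine ((pairing (grad f w)).le_opNorm v).trans ?_
      gcongr
      exact (norm_pairing_le _).trans (by gcongr; exact norm_grad_apply_le f w)
    calc _ ≤ 2 * ((d : ℝ) + 1) * ((d + 1) * ‖grad f‖) := by gcongr; exact this
      _ = _ := by ring
  rw [C1.norm_eq, C1.norm_eq, h1]
  have : (1 : ℝ) ≤ (d + 1) ^ 2 := by
    have : (0 : ℝ) ≤ d := by positivity
    nlinarith
  nlinarith [norm_nonneg (fn f)]

/-- `norm_smul` with its instance spelled out, as instance search does not find it on `C1 d`. -/
theorem C1.norm_smul_eq (c : ℂ) (f : C1 d) : ‖c • f‖ = ‖c‖ * ‖f‖ :=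
  @norm_smul ℂ (C1 d) _ _ _ (@NormedSpace.toNormSMulClass ℂ (C1 d) _ _ _) c f

/-- Decomposition into real and imaginary parts. -/
theorem exists_real_imag (f : C1 d) : ∃ f₁ f₂ : C1 d, f = f₁ + Complex.I • f₂ ∧
    (∀ w, (fn f₁ w).im = 0) ∧ (∀ w, (fn f₂ w).im = 0) ∧ ‖f₁‖ ≤ 2 * (d + 1) ^ 2 * ‖f‖ ∧
      ‖f₂‖ ≤ 2 * (d + 1) ^ 2 * ‖f‖ := by
  have h1 : (1 : ℝ) ≤ (d + 1) ^ 2 := by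
    have : (0 : ℝ) ≤ d := by positivity
    nlinarith
  have h2 := f.norm_conj_le
  have h3 := norm_nonneg f
  refine ⟨(1 / 2 : ℂ) • (f + f.conj), (-Complex.I / 2 : ℂ) • (f - f.conj), ?_, fun w => ?_,
    fun w => ?_, ?_, ?_⟩
  · rw [smul_smul, show Complex.I * (-Complex.I / 2) = 1 / 2 by
      linear_combination (-1 / 2 : ℂ) * Complex.I_mul_I]
    module
  · simp
  · simp
  · have h4 : ‖(1 / 2 : ℂ)‖ = 1 / 2 := by norm_num
    have h5 := norm_add_le f f.conj
    rw [C1.norm_smul_eq, h4]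
    nlinarith
  · have h4 : ‖(-Complex.I / 2 : ℂ)‖ = 1 / 2 := by norm_num
    have h5 := norm_sub_le f f.conj
    rw [C1.norm_smul_eq, h4]
    nlinarith

end Cone

/-! ### The branches of the transfer operator -/

section Branches

open Filter Topology

variable {d : ℕ}

/-- The last entry of `γ_{n-1}^A γ_j (w, 1)`, which is `1 + (A + 1) (1 - w_j)`, as an affine
function on the ambient space. -/
def denom (γ : Branch d) (x : EuclideanSpace ℝ (Fin (d + 1))) : ℝ :=
  1 + (γ.1 + 1) * (1 - x γ.2.castSucc)

/-- The first `n - 1` entries of `γ_{n-1}^A γ_j (w, 1)`: those of `w` other than `w_j`, followed by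
`1 + A (1 - w_j)`, which is the previous value of the last entry. -/
def numer (γ : Branch d) (x : EuclideanSpace ℝ (Fin (d + 1))) : Fin (d + 1) → ℝ :=
  Fin.snoc (α := fun _ => ℝ) (fun k : Fin d => x (γ.2.castSucc.succAbove k))
    (1 + γ.1 * (1 - x γ.2.castSucc))

/-- The map `γ_{n-1}` fixes the first `n - 2` entries `u`, and replaces `(a, b)` by `(b, ∑ u + b)`.
-/
theorem gen_last_snoc_snoc (u : Fin d → ℝ) (a b : ℝ) :
    gen (Fin.last d) (Fin.snoc (α := fun _ => ℝ) (Fin.snoc (α := fun _ => ℝ) u a) b) =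
      Fin.snoc (α := fun _ => ℝ) (Fin.snoc (α := fun _ => ℝ) u b) (∑ k, u k + b) := by
  have h : (fun i : Fin (d + 1) => (Fin.snoc (α := fun _ => ℝ) (Fin.snoc (α := fun _ => ℝ) u a) b
      : Fin (d + 2) → ℝ) ((Fin.last d).castSucc.succAbove i)) = Fin.snoc (α := fun _ => ℝ) u b := by
    funext i
    induction i using Fin.lastCases with
    | last =>
      rw [Fin.succAbove_of_le_castSucc _ _ le_rfl, Fin.succ_last, Fin.snoc_last, Fin.snoc_last]
    | cast k =>
      rw [Fin.succAbove_of_castSucc_lt _ _ (by simp [Fin.lt_def]), Fin.snoc_castSucc,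
        Fin.snoc_castSucc, Fin.snoc_castSucc]
  unfold gen
  rw [h, Fin.sum_univ_castSucc]
  simp

theorem sum_succAbove (w : Simplex d) (j : Fin (d + 1)) :
    ∑ k, w.1 (j.succAbove k) = 1 - w.1 j := by
  have := Fin.sum_univ_succAbove (fun i => w.1 i) j
  rw [w.2.2.2] at this
  linarith

theorem gen_castSucc_lift (j : Fin d) (w : Simplex d) :
    gen j.castSucc (lift w) = Fin.snoc (α := fun _ => ℝ) (Fin.snoc (α := fun _ => ℝ)
      (fun k : Fin d => w.1 (j.castSucc.succAbove k)) 1) (1 + (1 - w.1 j.castSucc)) := by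
  have h : (fun i : Fin (d + 1) => lift w (j.castSucc.castSucc.succAbove i)) =
      Fin.snoc (α := fun _ => ℝ) (fun k : Fin d => w.1 (j.castSucc.succAbove k)) 1 := by
    funext i
    induction i using Fin.lastCases with
    | last =>
      rw [Fin.succAbove_of_le_castSucc _ _ (by simp [Fin.le_def]), Fin.succ_last, Fin.snoc_last]
      simp [lift]
    | cast k =>
      rw [Fin.castSucc_succAbove_castSucc, lift, Fin.snoc_castSucc, Fin.snoc_castSucc]
  unfold gen
  rw [h, Fin.sum_univ_castSucc]
  simp only [Fin.snoc_castSucc, Fin.snoc_last, sum_succAbove]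
  congr 1
  ring

theorem branch_lift (γ : Branch d) (w : Simplex d) :
    branch γ (lift w) = Fin.snoc (α := fun _ => ℝ) (numer γ w.1) (denom γ w.1) := by
  obtain ⟨A, j⟩ := γ
  unfold branch numer denom
  dsimp only
  induction A with
  | zero => simp [gen_castSucc_lift]
  | succ A ih =>
    rw [Function.iterate_succ_apply', ih, gen_last_snoc_snoc, sum_succAbove]
    congr 1
    · congr 1; push_cast; ring
    · push_cast; ring

theorem act_apply (γ : Branch d) (w : Simplex d) (i : Fin (d + 1)) :
    (act γ w).1 i = numer γ w.1 i / denom γ w.1 := by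
  simp [act, proj, branch_lift]

/-- An entry other than the last is at most the last one, so at most half of the sum `1`. This is
where the restriction `j ≤ n - 2` enters: it keeps `denom` away from `1`. -/
theorem apply_castSucc_le (w : Simplex d) (j : Fin d) : w.1 j.castSucc ≤ 1 / 2 := by
  have h1 := w.2.2.2
  rw [Fin.sum_univ_castSucc] at h1
  have h2 : w.1 j.castSucc ≤ ∑ k : Fin d, w.1 k.castSucc :=
    Finset.single_le_sum (f := fun k : Fin d => w.1 k.castSucc) (fun k _ => w.2.1 _)
      (Finset.mem_univ j)
  have h3 := w.2.2.1 j.castSucc (Fin.last d) (Fin.le_last _)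
  linarith

theorem le_denom (γ : Branch d) (w : Simplex d) : ((γ.1 : ℝ) + 3) / 2 ≤ denom γ w.1 := by
  have := apply_castSucc_le w γ.2
  have : (0 : ℝ) ≤ γ.1 := by positivity
  unfold denom
  nlinarith

theorem denom_le (γ : Branch d) (w : Simplex d) : denom γ w.1 ≤ γ.1 + 2 := by
  have := w.2.1 γ.2.castSucc
  have : (0 : ℝ) ≤ γ.1 := by positivity
  unfold denom
  nlinarith

theorem denom_ge (γ : Branch d) (w : Simplex d) : 3 / 2 ≤ denom γ w.1 := by
  have h1 := le_denom γ w
  have : (0 : ℝ) ≤ γ.1 := by positivity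
  linarith

theorem denom_pos (γ : Branch d) (w : Simplex d) : 0 < denom γ w.1 := by
  linarith [denom_ge γ w]

theorem weight_eq (s : ℝ) (γ : Branch d) (w : Simplex d) : weight s γ w = denom γ w.1 ^ (-s) := by
  rw [weight, branch_lift, Fin.snoc_last, Real.rpow_neg (denom_pos γ w).le,
    ← Real.inv_rpow (denom_pos γ w).le, lift, Fin.snoc_last, one_div]

theorem weight_pos (s : ℝ) (γ : Branch d) (w : Simplex d) : 0 < weight s γ w := by
  rw [weight_eq]; exact Real.rpow_pos_of_pos (denom_pos γ w) _

/-- A bound for `weight s γ` on all of `Δ`, summable over `γ` when `s > 1`. -/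
noncomputable def weightBound (s : ℝ) (γ : Branch d) : ℝ := (((γ.1 : ℝ) + 3) / 2) ^ (-s)

theorem weightBound_nonneg (s : ℝ) (γ : Branch d) : 0 ≤ weightBound s γ :=
  Real.rpow_nonneg (by positivity) _

theorem weight_le {s : ℝ} (hs : 0 ≤ s) (γ : Branch d) (w : Simplex d) :
    weight s γ w ≤ weightBound s γ := by
  rw [weight_eq]
  exact Real.rpow_le_rpow_of_nonpos (by positivity) (le_denom γ w) (by linarith)

theorem summable_weightBound {s : ℝ} (hs : 1 < s) : Summable (weightBound s : Branch d → ℝ) := by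
  have h1 : Summable fun A : ℕ => (((A : ℝ) + 3) / 2) ^ (-s) := by
    have h2 : Summable fun A : ℕ => ((A + 3 : ℕ) : ℝ) ^ (-s) :=
      (summable_nat_add_iff 3).mpr (Real.summable_nat_rpow.mpr (by linarith))
    refine (h2.mul_right ((2⁻¹ : ℝ) ^ (-s))).congr fun A => ?_
    rw [← Real.mul_rpow (by positivity) (by positivity)]
    push_cast
    rfl
  have h3 := h1.mul_of_nonneg (g := fun _ : Fin d => (1 : ℝ)) (Summable.of_finite)
    (fun A => Real.rpow_nonneg (by positivity) _) (fun _ => zero_le_one)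
  exact h3.congr fun _ => mul_one _

/-- The derivative of `denom γ`. -/
noncomputable def denomDeriv (γ : Branch d) : EuclideanSpace ℝ (Fin (d + 1)) →L[ℝ] ℝ :=
  (-((γ.1 : ℝ) + 1)) • EuclideanSpace.proj γ.2.castSucc

/-- The derivatives of the entries of `numer γ`. -/
noncomputable def numerDeriv (γ : Branch d) :
    Fin (d + 1) → EuclideanSpace ℝ (Fin (d + 1)) →L[ℝ] ℝ :=
  Fin.snoc (α := fun _ => EuclideanSpace ℝ (Fin (d + 1)) →L[ℝ] ℝ)
    (fun k : Fin d => EuclideanSpace.proj (γ.2.castSucc.succAbove k))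
    ((-(γ.1 : ℝ)) • EuclideanSpace.proj γ.2.castSucc)

theorem hasFDerivAt_coord (i : Fin (d + 1)) (x : EuclideanSpace ℝ (Fin (d + 1))) :
    HasFDerivAt (fun x : EuclideanSpace ℝ (Fin (d + 1)) => x i) (EuclideanSpace.proj i :
      EuclideanSpace ℝ (Fin (d + 1)) →L[ℝ] ℝ) x :=
  (EuclideanSpace.proj i : EuclideanSpace ℝ (Fin (d + 1)) →L[ℝ] ℝ).hasFDerivAt

theorem hasFDerivAt_denom (γ : Branch d) (x : EuclideanSpace ℝ (Fin (d + 1))) :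
    HasFDerivAt (denom γ) (denomDeriv γ) x := by
  have := (((hasFDerivAt_coord γ.2.castSucc x).const_sub 1).const_mul ((γ.1 : ℝ) + 1)).const_add 1
  refine this.congr_fderiv ?_
  ext v; simp [denomDeriv]; ring

theorem hasFDerivAt_numer (γ : Branch d) (i : Fin (d + 1)) (x : EuclideanSpace ℝ (Fin (d + 1))) :
    HasFDerivAt (fun x => numer γ x i) (numerDeriv γ i) x := by
  induction i using Fin.lastCases with
  | last =>
    simp only [numer, numerDeriv, Fin.snoc_last]
    have := (((hasFDerivAt_coord γ.2.castSucc x).const_sub 1).const_mul (γ.1 : ℝ)).const_add 1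
    refine this.congr_fderiv ?_
    ext v; simp
  | cast k =>
    simp only [numer, numerDeriv, Fin.snoc_castSucc]
    exact hasFDerivAt_coord _ x

/-- The extension of `act γ` to the ambient space by the same formula, which is meaningful where
`denom γ` does not vanish. -/
noncomputable def actAmbient (γ : Branch d) (x : EuclideanSpace ℝ (Fin (d + 1))) :
    EuclideanSpace ℝ (Fin (d + 1)) :=
  WithLp.toLp 2 fun i => numer γ x i / denom γ x

/-- The derivative of the `i`-th entry of `actAmbient γ`, from the quotient rule. -/
noncomputable def coordDeriv (γ : Branch d) (x : EuclideanSpace ℝ (Fin (d + 1)))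
    (i : Fin (d + 1)) : EuclideanSpace ℝ (Fin (d + 1)) →L[ℝ] ℝ :=
  (denom γ x)⁻¹ • numerDeriv γ i - (numer γ x i / denom γ x ^ 2) • denomDeriv γ

/-- The derivative of `actAmbient γ`. -/
noncomputable def actDeriv (γ : Branch d) (x : EuclideanSpace ℝ (Fin (d + 1))) :
    EuclideanSpace ℝ (Fin (d + 1)) →L[ℝ] EuclideanSpace ℝ (Fin (d + 1)) :=
  ∑ i, (ContinuousLinearMap.toSpanSingleton ℝ (EuclideanSpace.single i (1 : ℝ))).comp
    (coordDeriv γ x i)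

theorem actAmbient_coe (γ : Branch d) (w : Simplex d) : actAmbient γ w.1 = (act γ w).1 := by
  ext i; rw [act_apply]; rfl

theorem actDeriv_apply (γ : Branch d) (x v : EuclideanSpace ℝ (Fin (d + 1))) (i : Fin (d + 1)) :
    actDeriv γ x v i = coordDeriv γ x i v := by
  simp [actDeriv, Pi.single_apply]

theorem hasFDerivAt_actAmbient (γ : Branch d) (w : Simplex d) :
    HasFDerivAt (actAmbient γ) (actDeriv γ w.1) w.1 := by
  rw [← hasFDerivWithinAt_univ, hasFDerivWithinAt_euclidean]
  intro i
  rw [hasFDerivWithinAt_univ]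
  have h := (hasFDerivAt_numer γ i w.1).mul
    ((hasDerivAt_inv (denom_pos γ w).ne').comp_hasFDerivAt w.1 (hasFDerivAt_denom γ w.1))
  refine (h.congr_fderiv ?_).congr_of_eventuallyEq (Eventually.of_forall fun x => ?_)
  · ext v
    rw [ContinuousLinearMap.comp_apply]
    change _ = actDeriv γ w.1 v i
    rw [actDeriv_apply]
    simp [coordDeriv]
    ring
  · simp [actAmbient, div_eq_mul_inv]

theorem coordDeriv_castSucc (γ : Branch d) (x v : EuclideanSpace ℝ (Fin (d + 1))) (k : Fin d) :
    coordDeriv γ x k.castSucc v = v (γ.2.castSucc.succAbove k) / denom γ x +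
      x (γ.2.castSucc.succAbove k) * ((γ.1 + 1) * v γ.2.castSucc / denom γ x ^ 2) := by
  simp [coordDeriv, numerDeriv, denomDeriv, numer]
  ring

/-- The last entry is a fractional linear function of `w_j` whose determinant is `1`, hence the
simple derivative. -/
theorem coordDeriv_last (γ : Branch d) (w : Simplex d) (v : EuclideanSpace ℝ (Fin (d + 1))) :
    coordDeriv γ w.1 (Fin.last d) v = v γ.2.castSucc / denom γ w.1 ^ 2 := by
  have := (denom_pos γ w).ne'
  simp [coordDeriv, numerDeriv, denomDeriv, numer]
  field_simp
  simp only [denom]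
  ring

theorem sum_actDeriv (γ : Branch d) (w : Simplex d) {v : EuclideanSpace ℝ (Fin (d + 1))}
    (hv : ∑ i, v i = 0) : ∑ i, actDeriv γ w.1 v i = 0 := by
  have hD := (denom_pos γ w).ne'
  simp only [actDeriv_apply]
  rw [Fin.sum_univ_castSucc, coordDeriv_last]
  simp only [coordDeriv_castSucc]
  rw [Finset.sum_add_distrib, ← Finset.sum_div, ← Finset.sum_mul, sum_succAbove]
  have h1 := Fin.sum_univ_succAbove (fun i => v i) γ.2.castSucc
  rw [hv] at h1
  have h2 : ∑ k, v (γ.2.castSucc.succAbove k) = - v γ.2.castSucc := by linarith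
  rw [h2]
  field_simp
  simp only [denom]
  ring

/-- The branches contract the `ℓ¹` norm by `1 / denom ≤ 2 / 3`: the contributions of `v_j` through
the denominator add up to exactly `|v_j| / denom`. -/
theorem l1_actDeriv_le (γ : Branch d) (w : Simplex d) (v : EuclideanSpace ℝ (Fin (d + 1))) :
    l1 (actDeriv γ w.1 v) ≤ 2 / 3 * l1 v := by
  have hD := denom_pos γ w
  have hA : (0 : ℝ) ≤ γ.1 := by positivity
  have h1 : l1 (actDeriv γ w.1 v) ≤ l1 v / denom γ w.1 := by
    unfold l1
    simp only [actDeriv_apply]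
    rw [Fin.sum_univ_castSucc, coordDeriv_last,
      Fin.sum_univ_succAbove (fun i => |v i|) γ.2.castSucc]
    have h2 : ∀ k : Fin d, |coordDeriv γ w.1 k.castSucc v| ≤
        |v (γ.2.castSucc.succAbove k)| / denom γ w.1 + w.1 (γ.2.castSucc.succAbove k) *
          ((γ.1 + 1) * |v γ.2.castSucc| / denom γ w.1 ^ 2) := by
      intro k
      rw [coordDeriv_castSucc]
      refine (abs_add_le _ _).trans_eq ?_
      rw [abs_div, abs_mul, abs_div, abs_mul, abs_of_pos hD, abs_of_nonneg (w.2.1 _),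
        abs_of_nonneg (by positivity : (0 : ℝ) ≤ γ.1 + 1), abs_of_pos (pow_pos hD 2)]
    refine (add_le_add_left (Finset.sum_le_sum fun k _ => h2 k) _).trans_eq ?_
    rw [Finset.sum_add_distrib, ← Finset.sum_div, ← Finset.sum_mul, sum_succAbove, abs_div,
      abs_of_pos (pow_pos hD 2)]
    field_simp
    simp only [denom]
    ring
  refine h1.trans ?_
  rw [div_le_iff₀ hD]
  nlinarith [l1_nonneg v, denom_ge γ w]

theorem abs_denomDeriv_le (γ : Branch d) (w : Simplex d) (v : EuclideanSpace ℝ (Fin (d + 1))) :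
    |denomDeriv γ v| ≤ 2 * denom γ w.1 * l1 v := by
  have hA : (0 : ℝ) ≤ γ.1 := by positivity
  have h1 : |v γ.2.castSucc| ≤ l1 v :=
    Finset.single_le_sum (f := fun i => |v i|) (fun i _ => abs_nonneg _) (Finset.mem_univ _)
  have h2 : |denomDeriv γ v| = (γ.1 + 1) * |v γ.2.castSucc| := by
    simp only [denomDeriv, FunLike.coe_smul, Pi.smul_apply, PiLp.proj_apply, smul_eq_mul,
      abs_mul, abs_neg]
    rw [abs_of_nonneg (by positivity)]
  rw [h2]
  have h3 := le_denom γ w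
  have h4 : (γ.1 : ℝ) + 1 ≤ 2 * denom γ w.1 := by linarith
  exact mul_le_mul h4 h1 (abs_nonneg _) (by linarith)

theorem continuous_denom (γ : Branch d) : Continuous (denom γ) := by
  unfold denom; fun_prop

theorem continuous_numer (γ : Branch d) (i : Fin (d + 1)) : Continuous fun x => numer γ x i :=
  continuous_iff_continuousAt.mpr fun x => (hasFDerivAt_numer γ i x).continuousAt

theorem continuous_act (γ : Branch d) : Continuous (act γ) := by
  rw [continuous_induced_rng]
  refine (PiLp.continuous_toLp 2 _).comp (continuous_pi fun i => ?_)
    |>.congr fun w => (actAmbient_coe γ w)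
  exact ((continuous_numer γ i).comp continuous_subtype_val).div
    ((continuous_denom γ).comp continuous_subtype_val) fun w => (denom_pos γ w).ne'

theorem continuous_weight (s : ℝ) (γ : Branch d) : Continuous (weight s γ) := by
  simp only [funext (weight_eq s γ)]
  exact ((continuous_denom γ).comp continuous_subtype_val).rpow_const
    fun w => Or.inl (denom_pos γ w).ne'

theorem continuous_actDeriv (γ : Branch d) : Continuous fun w : Simplex d => actDeriv γ w.1 := by
  unfold actDeriv coordDeriv
  have hD : Continuous fun w : Simplex d => denom γ w.1 :=
    (continuous_denom γ).comp continuous_subtype_val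
  refine continuous_finsetSum _ fun i _ => continuous_const.clm_comp
    (((hD.inv₀ fun w => (denom_pos γ w).ne').smul continuous_const).sub
      (((((continuous_numer γ i).comp continuous_subtype_val).div (hD.pow 2)
        fun w => (pow_pos (denom_pos γ w) 2).ne')).smul continuous_const))

/-- The derivative within `Δ` of `w ↦ weight s γ w * f (act γ w)`. -/
noncomputable def branchDeriv (s : ℝ) (γ : Branch d) (f : C1 d) (w : Simplex d) :
    EuclideanSpace ℝ (Fin (d + 1)) →L[ℝ] ℂ :=
  weight s γ w • (pairing (grad f (act γ w))).comp (actDeriv γ w.1) +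
    (((-s * denom γ w.1 ^ (-s - 1) : ℝ) : ℂ) * fn f (act γ w)) •
      Complex.ofRealCLM.comp (denomDeriv γ)

theorem continuous_branchDeriv (s : ℝ) (γ : Branch d) (f : C1 d) :
    Continuous (branchDeriv s γ f) := by
  have hD : Continuous fun w : Simplex d => denom γ w.1 :=
    (continuous_denom γ).comp continuous_subtype_val
  refine ((continuous_weight s γ).smul ((continuous_pairing.comp
    ((grad f).continuous.comp (continuous_act γ))).clm_comp (continuous_actDeriv γ))).add
    (((Complex.continuous_ofReal.comp (continuous_const.mul
      (hD.rpow_const fun w => Or.inl (denom_pos γ w).ne'))).mul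
      ((fn f).continuous.comp (continuous_act γ))).smul continuous_const)

theorem hasFDerivWithinAt_branch (s : ℝ) (γ : Branch d) (f : C1 d) (w : Simplex d) :
    HasFDerivWithinAt (fun x => (denom γ x ^ (-s)) • extendZero (fn f) (actAmbient γ x))
      (branchDeriv s γ f w) (simplex d) w.1 := by
  have h1 : HasFDerivWithinAt (extendZero (fn f)) (pairing (grad f (act γ w))) (simplex d)
      (actAmbient γ w.1) := by
    rw [actAmbient_coe]; exact f.isGradient.hasFDerivWithinAt _
  have h2 := h1.comp w.1 (hasFDerivAt_actAmbient γ w).hasFDerivWithinAt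
    (fun x hx => by rw [actAmbient_coe γ ⟨x, hx⟩]; exact (act γ ⟨x, hx⟩).2)
  have h3 := ((hasFDerivAt_denom γ w.1).hasFDerivWithinAt (s := simplex d)).rpow_const (p := -s)
    (Or.inl (denom_pos γ w).ne')
  refine (h3.smul h2).congr_fderiv ?_
  ext v
  simp [branchDeriv, weight_eq, actAmbient_coe]
  ring

/-- The logarithmic derivative of the weight `denom ^ (-s)` is bounded by `2 s` in `ℓ¹` norm,
uniformly in `γ`. -/
theorem norm_branchDeriv_apply_le {s : ℝ} (hs : 0 ≤ s) (γ : Branch d) (f : C1 d) (w : Simplex d)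
    (v : EuclideanSpace ℝ (Fin (d + 1))) :
    ‖branchDeriv s γ f w v‖ ≤ weight s γ w *
      (‖pairing (grad f (act γ w)) (actDeriv γ w.1 v)‖ + 2 * s * l1 v * ‖fn f (act γ w)‖) := by
  have hD := denom_pos γ w
  have h1 : branchDeriv s γ f w v = (weight s γ w : ℂ) *
      (pairing (grad f (act γ w)) (actDeriv γ w.1 v) +
        ((-s * denomDeriv γ v / denom γ w.1 : ℝ) : ℂ) * fn f (act γ w)) := by
    have : denom γ w.1 ^ (-s - 1) = weight s γ w / denom γ w.1 := by
      rw [weight_eq, Real.rpow_sub_one hD.ne']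
    simp [branchDeriv, this]
    ring
  rw [h1, norm_mul, Complex.norm_real, Real.norm_of_nonneg (weight_pos s γ w).le]
  refine mul_le_mul_of_nonneg_left ((norm_add_le _ _).trans (add_le_add_right ?_ _))
    (weight_pos s γ w).le
  rw [norm_mul, Complex.norm_real, Real.norm_eq_abs]
  refine mul_le_mul_of_nonneg_right ?_ (norm_nonneg _)
  rw [abs_div, abs_mul, abs_neg, abs_of_nonneg hs, abs_of_pos hD, div_le_iff₀ hD]
  nlinarith [abs_denomDeriv_le γ w v]

end Branches

/-! ### The transfer operator -/

section TransferOperator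

open Filter Topology

variable {d : ℕ}

theorem exists_hasSum_operator {ι E : Type*} [NormedAddCommGroup E] [NormedSpace ℂ E]
    [CompleteSpace E] (T : ι → E → E) (hadd : ∀ i f g, T i (f + g) = T i f + T i g)
    (hsmul : ∀ i (a : ℂ) f, T i (a • f) = a • T i f) (c : ι → ℝ) (hc0 : ∀ i, 0 ≤ c i)
    (hc : Summable c)
    (hT : ∀ i f, ‖T i f‖ ≤ c i * ‖f‖) :
    ∃ L : E →L[ℂ] E, ∀ f, HasSum (fun i => T i f) (L f) := by
  let U : ι → E →L[ℂ] E := fun i => LinearMap.mkContinuous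
    { toFun := T i, map_add' := hadd i, map_smul' := hsmul i } (c i) (hT i)
  have h : Summable U :=
    Summable.of_norm_bounded hc fun i => LinearMap.mkContinuous_norm_le _ (hc0 i) _
  refine ⟨∑' i, U i, fun f => ?_⟩
  have h2 : HasSum (fun i => U i f) ((∑' i, U i) f) :=
    h.hasSum.mapL (ContinuousLinearMap.apply ℂ E f)
  exact h2

/-- The term of the transfer operator on `C⁰(Δ)` that belongs to `γ`. -/
noncomputable def branchFn (s : ℝ) (γ : Branch d) (f : C(Simplex d, ℂ)) :
    C(Simplex d, ℂ) :=
  ⟨fun w => (weight s γ w : ℂ) * f (act γ w),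
    (Complex.continuous_ofReal.comp (continuous_weight s γ)).mul
      (f.continuous.comp (continuous_act γ))⟩

theorem branchFn_apply (s : ℝ) (γ : Branch d) (f : C(Simplex d, ℂ)) (w : Simplex d) :
    branchFn s γ f w = (weight s γ w : ℂ) * f (act γ w) := rfl

theorem branchFn_add (s : ℝ) (γ : Branch d) (f g : C(Simplex d, ℂ)) :
    branchFn s γ (f + g) = branchFn s γ f + branchFn s γ g := by
  ext w; simp [branchFn_apply, mul_add]

theorem branchFn_smul (s : ℝ) (γ : Branch d) (c : ℂ) (f : C(Simplex d, ℂ)) :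
    branchFn s γ (c • f) = c • branchFn s γ f := by
  ext w; simp [branchFn_apply]; ring

theorem norm_branchFn_le {s : ℝ} (hs : 0 ≤ s) (γ : Branch d) (f : C(Simplex d, ℂ)) :
    ‖branchFn s γ f‖ ≤ weightBound s γ * ‖f‖ := by
  rw [ContinuousMap.norm_le _ (mul_nonneg (weightBound_nonneg s γ) (norm_nonneg f))]
  intro w
  rw [branchFn_apply, norm_mul, Complex.norm_real, Real.norm_of_nonneg (weight_pos s γ w).le]
  exact mul_le_mul (weight_le hs γ w) (f.norm_coe_le_norm _) (norm_nonneg _)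
    (weightBound_nonneg s γ)

/-- The term of the transfer operator on `C¹(Δ)` that belongs to `γ`. -/
noncomputable def branchC1 (s : ℝ) (γ : Branch d) (f : C1 d) : C1 d :=
  C1.mk' (branchFn s γ (fn f))
    (fun x => (denom γ x ^ (-s)) • extendZero (fn f) (actAmbient γ x))
    ⟨branchDeriv s γ f, continuous_branchDeriv s γ f⟩
    (fun w => by rw [actAmbient_coe, extendZero_coe, branchFn_apply, weight_eq]; rfl)
    (hasFDerivWithinAt_branch s γ f)

@[simp] theorem fn_branchC1 (s : ℝ) (γ : Branch d) (f : C1 d) :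
    fn (branchC1 s γ f) = branchFn s γ (fn f) := rfl

theorem grad_branchC1 (s : ℝ) (γ : Branch d) (f : C1 d) (w : Simplex d) :
    grad (branchC1 s γ f) w = tangentVec (branchDeriv s γ f w) := rfl

theorem branchC1_add (s : ℝ) (γ : Branch d) (f g : C1 d) :
    branchC1 s γ (f + g) = branchC1 s γ f + branchC1 s γ g :=
  C1.ext_fn (branchFn_add s γ (fn f) (fn g))

theorem branchC1_smul (s : ℝ) (γ : Branch d) (c : ℂ) (f : C1 d) :
    branchC1 s γ (c • f) = c • branchC1 s γ f :=
  C1.ext_fn (branchFn_smul s γ c (fn f))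

theorem norm_branchC1_le {s : ℝ} (hs : 0 ≤ s) (γ : Branch d) (f : C1 d) :
    ‖branchC1 s γ f‖ ≤ (1 + 2 * (d + 1) ^ 2 * (1 + 2 * s)) * weightBound s γ * ‖f‖ := by
  have hB := weightBound_nonneg s γ
  have h0 := norm_nonneg (grad f)
  have h0' := norm_nonneg (fn f)
  have h1 := norm_branchFn_le hs γ (fn f)
  have h2 : ‖grad (branchC1 s γ f)‖ ≤ 2 * (d + 1) ^ 2 * (1 + 2 * s) * weightBound s γ * ‖f‖ := by
    have hf : 0 ≤ ‖f‖ := norm_nonneg f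
    rw [ContinuousMap.norm_le _ (by positivity)]
    intro w
    rw [grad_branchC1]
    have h3 : ‖branchDeriv s γ f w‖ ≤ (d + 1) * (1 + 2 * s) * weightBound s γ * ‖f‖ := by
      refine ContinuousLinearMap.opNorm_le_bound _ (by positivity) fun v => ?_
      have hl := l1_nonneg v
      have hw := (weight_pos s γ w).le
      calc ‖branchDeriv s γ f w v‖ ≤ weight s γ w *
            (‖grad f‖ * (2 / 3 * l1 v) + 2 * s * l1 v * ‖fn f‖) := by
            refine (norm_branchDeriv_apply_le hs γ f w v).trans ?_
            gcongr
            · refine (norm_pairing_apply_le_l1 _ _).trans ?_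
              exact mul_le_mul (norm_grad_apply_le f _) (l1_actDeriv_le γ w v) (l1_nonneg _) h0
            · exact norm_fn_apply_le f _
        _ ≤ weight s γ w * ((1 + 2 * s) * l1 v * ‖f‖) := by
            gcongr
            rw [C1.norm_eq]
            have e1 : 0 ≤ l1 v * ‖grad f‖ := by positivity
            have e2 : 0 ≤ s * (l1 v * ‖grad f‖) := by positivity
            have e3 : 0 ≤ l1 v * ‖fn f‖ := by positivity
            nlinarith
        _ ≤ weightBound s γ * ((1 + 2 * s) * ((d + 1) * ‖v‖) * ‖f‖) := by
            gcongr
            · exact weight_le hs γ w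
            · exact l1_le v
        _ = _ := by ring
    refine (norm_tangentVec_le _).trans ?_
    calc _ ≤ 2 * ((d : ℝ) + 1) * ((d + 1) * (1 + 2 * s) * weightBound s γ * ‖f‖) := by gcongr
      _ = _ := by ring
  have h3 : weightBound s γ * ‖fn f‖ ≤ weightBound s γ * ‖f‖ := by
    rw [C1.norm_eq]; gcongr; linarith
  rw [C1.norm_eq (branchC1 s γ f), fn_branchC1]
  linarith

/-- Lasota–Yorke inequality on the cones: the contraction of the branches improves the constant `a`
by the factor `2 / 3`, and the weight adds `2 s`. -/
theorem branchC1_mem_logCone {s a : ℝ} (hs : 0 ≤ s) (ha : 0 ≤ a) (γ : Branch d) {f : C1 d}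
    (hf : f ∈ logCone d a) :
    branchC1 s γ f ∈ logCone d (2 * s + 2 / 3 * a) := by
  intro w
  obtain ⟨f1, f2, f3⟩ := hf (act γ w)
  have hw := (weight_pos s γ w).le
  refine ⟨by simp [branchFn_apply, f1], by simpa [branchFn_apply] using mul_nonneg hw f2,
    fun v hv => ?_⟩
  have hl := l1_nonneg v
  rw [grad_branchC1, pairing_tangentVec _ hv]
  calc _ ≤ weight s γ w * (a * (2 / 3 * l1 v) * (fn f (act γ w)).re +
        2 * s * l1 v * (fn f (act γ w)).re) := by
        refine (norm_branchDeriv_apply_le hs γ f w v).trans ?_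
        rw [norm_fn_of_mem hf]
        gcongr
        refine (f3 _ (sum_actDeriv γ w hv)).trans ?_
        gcongr
        exact l1_actDeriv_le γ w v
    _ = _ := by simp [branchFn_apply]; ring

theorem exists_hasSum_branchFn {s : ℝ} (hs : 1 < s) :
    ∃ L₀ : C(Simplex d, ℂ) →L[ℂ] C(Simplex d, ℂ), ∀ f, HasSum (fun γ => branchFn s γ f) (L₀ f) :=
  exists_hasSum_operator (branchFn s) (branchFn_add s) (branchFn_smul s) (weightBound s)
    (weightBound_nonneg s) (summable_weightBound hs) (norm_branchFn_le (by linarith))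

theorem exists_hasSum_branchC1 {s : ℝ} (hs : 1 < s) :
    ∃ L : C1 d →L[ℂ] C1 d, ∀ f, HasSum (fun γ => branchC1 s γ f) (L f) := by
  have hs0 : 0 ≤ s := by linarith
  set c : Branch d → ℝ := fun γ => (1 + 2 * (d + 1) ^ 2 * (1 + 2 * s)) * weightBound s γ
  have h1 : ∀ γ, 0 ≤ c γ := fun γ => mul_nonneg (by positivity) (weightBound_nonneg s γ)
  have h2 : Summable c := (summable_weightBound hs).mul_left _
  have h3 : ∀ γ f, ‖branchC1 s γ f‖ ≤ c γ * ‖f‖ := norm_branchC1_le hs0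
  exact exists_hasSum_operator (E := C1 d) (branchC1 s) (branchC1_add s) (branchC1_smul s) c h1 h2
    h3

theorem zero_mem_logCone {a : ℝ} : (0 : C1 d) ∈ logCone d a := by
  have h1 : fn (0 : C1 d) = 0 := rfl
  have h2 : grad (0 : C1 d) = 0 := rfl
  intro w
  rw [h1, h2]
  exact ⟨rfl, le_rfl, fun v _ => by simp [pairing]⟩

theorem hasSum_mem_logCone {ι : Type*} {a : ℝ} {u : ι → C1 d} {f : C1 d}
    (hu : ∀ i, u i ∈ logCone d a) (h : HasSum u f) : f ∈ logCone d a := by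
  refine isClosed_logCone.mem_of_tendsto h (Eventually.of_forall fun S => ?_)
  classical
  induction S using Finset.induction_on with
  | empty => exact zero_mem_logCone
  | insert γ S hγ ih =>
    rw [Finset.sum_insert hγ]
    exact add_mem_logCone (hu γ) ih

theorem hasSum_fn {ι : Type*} {u : ι → C1 d} {f : C1 d} (h : HasSum u f) :
    HasSum (fun i => fn (u i)) (fn f) :=
  h.map fnL fnL.continuous

theorem exists_transfer {s : ℝ} (hs : 1 < s) :
    ∃ (L₀ : C(Simplex d, ℂ) →L[ℂ] C(Simplex d, ℂ)) (L : C1 d →L[ℂ] C1 d),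
      (∀ f : C(Simplex d, ℂ), IsTransfer s f (L₀ f)) ∧ (∀ f, fn (L f) = L₀ (fn f)) ∧
      ∀ a, 0 ≤ a → ∀ f ∈ logCone d a, L f ∈ logCone d (2 * s + 2 / 3 * a) := by
  have hs0 : 0 ≤ s := by linarith
  obtain ⟨L₀, hL₀⟩ := exists_hasSum_branchFn (d := d) hs
  obtain ⟨L, hL⟩ := exists_hasSum_branchC1 (d := d) hs
  exact ⟨L₀, L, fun f w => (hL₀ f).mapL (ContinuousMap.evalCLM ℂ w),
    fun f => (hasSum_fn (hL f)).unique (hL₀ (fn f)),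
    fun a ha f hf => hasSum_mem_logCone (fun γ => branchC1_mem_logCone hs0 ha γ hf) (hL f)⟩

theorem simplex_nonempty : Nonempty (Simplex d) :=
  ⟨normalize (fun _ => 1) (fun _ => one_pos) monotone_const⟩

/-- The functional `f ↦ Re f(w)`, which controls the norm on `logCone`. -/
noncomputable def evalRe (w : Simplex d) : C1 d →L[ℝ] ℝ :=
  Complex.reCLM.comp (((ContinuousMap.evalCLM ℂ w).comp fnL).restrictScalars ℝ)

@[simp] theorem evalRe_apply (w : Simplex d) (f : C1 d) : evalRe w f = (fn f w).re := rfl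

/-- The relative size of the spectral gap: the Harnack constant `exp (24 s)` of `logCone d (12 s)`
enters twice, and `11 = (12 s + 10 s) / (12 s - 10 s)` is the factor in `sub_mem_logCone`. -/
noncomputable def gapConst (s : ℝ) : ℝ := Real.exp (-(48 * s)) / 11

theorem gapConst_pos (s : ℝ) : 0 < gapConst s := by unfold gapConst; positivity

theorem gapConst_lt_one {s : ℝ} (hs : 0 ≤ s) : gapConst s < 1 := by
  have : Real.exp (-(48 * s)) ≤ 1 := Real.exp_le_one_iff.mpr (by linarith)
  unfold gapConst
  linarith

variable {s : ℝ} {L : C1 d →L[ℂ] C1 d}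

/-- The constant `12 s` is twice the fixed point `6 s` of `a ↦ 2 s + 2 a / 3`, so the operator maps
`logCone d (12 s)` into `logCone d (10 s)`. -/
theorem isConeContraction_transfer (hs : 1 < s)
    (hL : ∀ a, 0 ≤ a → ∀ f ∈ logCone d a, L f ∈ logCone d (2 * s + 2 / 3 * a)) (w₀ : Simplex d) :
    IsConeContraction (E := C1 d) (L.restrictScalars ℝ) (logCone d (12 * s)) (evalRe w₀)
      (gapConst s) ((1 + 2 * (12 * s) * (d + 1)) * Real.exp (2 * (12 * s))) := by
  have hs0 : 0 < s := by linarith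
  have hL' : ∀ f ∈ logCone d (12 * s), L f ∈ logCone d (10 * s) := fun f hf => by
    have := hL _ (by positivity) f hf
    rwa [show 2 * s + 2 / 3 * (12 * s) = 10 * s by ring] at this
  refine ⟨add_mem_logCone, smul_mem_logCone, isClosed_logCone,
    fun hf => logCone_mono (by linarith) (hL' _ hf), by positivity,
    fun hf => norm_le_of_mem_logCone (by positivity) hf w₀, gapConst_pos s,
    (gapConst_lt_one hs0.le).le, fun {f g} hf hg => ?_⟩
  have hf' := hL' f hf
  have hg' := hL' g hg
  have f0 : 0 ≤ (fn (L f) w₀).re := (hf' w₀).2.1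
  have g0 : 0 ≤ (fn (L g) w₀).re := (hg' w₀).2.1
  refine sub_mem_logCone (b := 10 * s) (by linarith) (by positivity) (smul_mem_logCone g0 hf')
    (smul_mem_logCone (mul_nonneg (gapConst_pos s).le f0) hg') fun w => ?_
  have h1 : (fn (L g) w).re ≤ Real.exp (24 * s) * (fn (L g) w₀).re := by
    have := harnack (by positivity) (logCone_mono (b := 12 * s) (by linarith) hg') w₀ w
    rwa [show 2 * (12 * s) = 24 * s by ring] at this
  have h2 : (fn (L f) w₀).re ≤ Real.exp (24 * s) * (fn (L f) w).re := by
    have := harnack (by positivity) (logCone_mono (b := 12 * s) (by linarith) hf') w w₀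
    rwa [show 2 * (12 * s) = 24 * s by ring] at this
  have h3 : Real.exp (-(48 * s)) * (Real.exp (24 * s) * Real.exp (24 * s)) = 1 := by
    rw [← Real.exp_add, ← Real.exp_add, ← Real.exp_zero]; congr 1; ring
  have g1 : 0 ≤ (fn (L g) w).re := (hg' w).2.1
  have f1 : 0 ≤ (fn (L f) w).re := (hf' w).2.1
  have h4 : Real.exp (-(48 * s)) * (fn (L f) w₀).re * (fn (L g) w).re ≤
      (fn (L g) w₀).re * (fn (L f) w).re := by
    calc _ ≤ Real.exp (-(48 * s)) * (Real.exp (24 * s) * (fn (L f) w).re) *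
          (Real.exp (24 * s) * (fn (L g) w₀).re) := by gcongr
      _ = (Real.exp (-(48 * s)) * (Real.exp (24 * s) * Real.exp (24 * s))) *
          ((fn (L g) w₀).re * (fn (L f) w).re) := by ring
      _ = _ := by rw [h3, one_mul]
  simp only [fn_real_smul, ContinuousMap.smul_apply, Complex.real_smul, Complex.re_ofReal_mul,
    evalRe_apply, ContinuousLinearMap.coe_restrictScalars', gapConst]
  nlinarith

/-- Bounds for `ℒ_s 1` in the order of the cone. The lower one comes from the single term `A = 0`,
`j = 1`, whose denominator is at most `2`; such a term exists because `d > 0`. -/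
theorem transfer_one_bounds (hs : 1 < s) (hd : 0 < d)
    (hT : ∀ f : C1 d, IsTransfer s (fn f) (fn (L f)))
    (hL : ∀ a, 0 ≤ a → ∀ f ∈ logCone d a, L f ∈ logCone d (2 * s + 2 / 3 * a)) :
    L (C1.const 1) - ((2 : ℝ) ^ (-s) / 11) • (C1.const 1 : C1 d) ∈ logCone d (12 * s) ∧
      ∃ M : ℝ, M • (C1.const 1 : C1 d) - L (C1.const 1) ∈ logCone d (12 * s) := by
  have hs0 : 0 < s := by linarith
  have h1K : ∀ a, 0 ≤ a → (C1.const 1 : C1 d) ∈ logCone d a := fun a ha => by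
    simpa using const_mem_logCone (d := d) zero_le_one ha
  have hL1 : L (C1.const 1) ∈ logCone d (10 * s) :=
    logCone_mono (by linarith) (hL 0 le_rfl _ (h1K 0 le_rfl))
  have hlow : ∀ w, (2 : ℝ) ^ (-s) ≤ (fn (L (C1.const 1)) w).re := by
    intro w
    have h2 := Complex.hasSum_re (hT (C1.const 1) w)
    simp only [C1.fn_const, ContinuousMap.const_apply, mul_one, Complex.ofReal_re] at h2
    refine le_trans ?_ (le_hasSum h2 (0, ⟨0, hd⟩) fun γ _ => (weight_pos s γ w).le)
    rw [weight_eq]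
    refine Real.rpow_le_rpow_of_nonpos (denom_pos _ w) ?_ (by linarith)
    simpa using denom_le (0, ⟨0, hd⟩) w
  refine ⟨sub_mem_logCone (b := 10 * s) (by linarith) (by positivity) hL1
    (smul_mem_logCone (by positivity) (h1K _ (by positivity))) fun w => ?_,
    11 * ‖fn (L (C1.const 1))‖, sub_mem_logCone (b := 10 * s) (by linarith) (by positivity)
    (smul_mem_logCone (by positivity) (h1K _ (by positivity))) hL1 fun w => ?_⟩
  · have := hlow w
    simp
    nlinarith
  · have h2 := norm_fn_apply_le (L (C1.const 1)) w
    rw [norm_fn_of_mem hL1] at h2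
    simp
    nlinarith

end TransferOperator

/-! ### The eigenmeasure -/

section Eigenmeasure

open Filter Topology MeasureTheory

/-- Uniformly bounded linear functionals that converge on a dense set converge everywhere. -/
theorem exists_limit_functional {V : Type*} [NormedAddCommGroup V] [NormedSpace ℂ V]
    (A : ℕ → V →ₗ[ℂ] ℂ) {C : ℝ} (hA : ∀ k f, ‖A k f‖ ≤ C * ‖f‖) {S : Set V} (hS : Dense S)
    (h : ∀ f ∈ S, CauchySeq fun k => A k f) :
    ∃ Λ : V →ₗ[ℂ] ℂ, ∀ f, Tendsto (fun k => A k f) atTop (𝓝 (Λ f)) := by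
  have hcauchy : ∀ f, CauchySeq fun k => A k f := by
    intro f
    rw [Metric.cauchySeq_iff']
    intro ε hε
    have hC : 0 < |C| + 1 := by positivity
    obtain ⟨g, hg, hfg⟩ := Metric.dense_iff.mp hS f (ε / (3 * (|C| + 1))) (by positivity)
    have hclose : ∀ k, dist (A k f) (A k g) < ε / 3 := by
      intro k
      rw [dist_eq_norm, ← map_sub]
      have h1 : ‖f - g‖ < ε / (3 * (|C| + 1)) := by rw [← dist_eq_norm, dist_comm]; exact hg
      calc ‖A k (f - g)‖ ≤ C * ‖f - g‖ := hA k _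
        _ ≤ (|C| + 1) * ‖f - g‖ := by gcongr; linarith [le_abs_self C]
        _ < (|C| + 1) * (ε / (3 * (|C| + 1))) := by gcongr
        _ = ε / 3 := by field_simp
    obtain ⟨N, hN⟩ := Metric.cauchySeq_iff'.mp (h g hfg) (ε / 3) (by positivity)
    refine ⟨N, fun k hk => ?_⟩
    have h1 := hclose k
    have h2 := hclose N
    have h3 := hN k hk
    rw [dist_comm] at h2
    have h4 := dist_triangle4 (A k f) (A k g) (A N g) (A N f)
    linarith
  choose Λ hΛ using fun f => cauchySeq_tendsto_of_complete (hcauchy f)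
  exact ⟨linearMapOfTendsto Λ A (tendsto_pi_nhds.mpr hΛ), hΛ⟩

/-- The Riesz–Markov–Kakutani theorem for positive normalised functionals on complex functions. -/
theorem exists_probabilityMeasure {X : Type*} [TopologicalSpace X] [CompactSpace X] [T2Space X]
    [MeasurableSpace X] [BorelSpace X] (Λ : C(X, ℂ) →ₗ[ℂ] ℂ)
    (hpos : ∀ f : C(X, ℂ), (∀ x, (f x).im = 0 ∧ 0 ≤ (f x).re) → (Λ f).im = 0 ∧ 0 ≤ (Λ f).re)
    (h1 : Λ 1 = 1) :
    ∃ ν : ProbabilityMeasure X, ∀ f : C(X, ℂ), ∫ x, f x ∂(ν : Measure X) = Λ f := by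
  let emb : C(X, ℝ) → C(X, ℂ) := fun f => ⟨fun x => (f x : ℂ), by fun_prop⟩
  have hemb_add : ∀ f g, emb (f + g) = emb f + emb g := fun f g => by ext x; simp [emb]
  have hemb_smul : ∀ (c : ℝ) f, emb (c • f) = (c : ℂ) • emb f := fun c f => by ext x; simp [emb]
  let Λr : CompactlySupportedContinuousMap X ℝ →ₗ[ℝ] ℝ :=
    { toFun := fun f => (Λ (emb f.toContinuousMap)).re
      map_add' := fun f g => by
        have : emb (f + g).toContinuousMap = emb f.toContinuousMap + emb g.toContinuousMap :=
          hemb_add _ _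
        rw [this, map_add, Complex.add_re]
      map_smul' := fun c f => by
        have : emb (c • f).toContinuousMap = (c : ℂ) • emb f.toContinuousMap := hemb_smul _ _
        rw [this, map_smul]
        simp }
  let Λp : CompactlySupportedContinuousMap X ℝ →ₚ[ℝ] ℝ := PositiveLinearMap.mk₀ Λr fun f hf =>
    (hpos _ fun x => ⟨by simp [emb], by simpa [emb] using hf x⟩).2
  -- A real function is a difference of two nonnegative ones.
  have him : ∀ f : C(X, ℝ), (Λ (emb f)).im = 0 := by
    intro f
    have e : emb f = emb (f + ‖f‖ • 1) - emb (‖f‖ • 1) := by ext x; simp [emb]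
    have h2 := (hpos (emb (f + ‖f‖ • 1)) fun x => ⟨by simp [emb], by
      have := (abs_le.mp (f.norm_coe_le_norm x)).1
      simp [emb]; linarith⟩).1
    have h3 := (hpos (emb (‖f‖ • 1)) fun x => ⟨by simp [emb], by simp [emb]⟩).1
    rw [e, map_sub, Complex.sub_im, h2, h3, sub_zero]
  have hint : ∀ f : C(X, ℝ), ∫ x, f x ∂(RealRMK.rieszMeasure Λp) = (Λ (emb f)).re := fun f =>
    RealRMK.integral_rieszMeasure Λp ⟨f, HasCompactSupport.of_compactSpace _⟩
  have huniv : (RealRMK.rieszMeasure Λp).real Set.univ = 1 := by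
    have h2 := hint 1
    have h3 : emb 1 = 1 := by ext x; simp [emb]
    simpa [h3, h1] using h2
  have hprob : IsProbabilityMeasure (RealRMK.rieszMeasure Λp) :=
    ⟨by rw [Measure.real, ENNReal.toReal_eq_one_iff] at huniv; exact huniv⟩
  refine ⟨⟨RealRMK.rieszMeasure Λp, hprob⟩, fun f => ?_⟩
  let u : C(X, ℝ) := ⟨fun x => (f x).re, by fun_prop⟩
  let v : C(X, ℝ) := ⟨fun x => (f x).im, by fun_prop⟩
  have hf : f = emb u + Complex.I • emb v := by
    ext x
    simp [emb, u, v, mul_comm Complex.I, Complex.re_add_im]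
  have hcoe : ∀ g : C(X, ℝ), Λ (emb g) = ((∫ x, g x ∂(RealRMK.rieszMeasure Λp) : ℝ) : ℂ) := fun g =>
    Complex.ext (by simp [hint]) (by simp [him])
  have hi : Integrable f (RealRMK.rieszMeasure Λp) :=
    f.continuous.integrable_of_hasCompactSupport (HasCompactSupport.of_compactSpace _)
  change ∫ x, f x ∂(RealRMK.rieszMeasure Λp) = Λ f
  rw [hf, map_add, map_smul, hcoe, hcoe, ← hf, ← integral_re_add_im hi]
  simp [u, v, mul_comm Complex.I]

variable {d : ℕ} {s : ℝ} {L₀ : C(Simplex d, ℂ) →L[ℂ] C(Simplex d, ℂ)}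

theorem norm_transfer_apply_le (hL₀ : ∀ f : C(Simplex d, ℂ), IsTransfer s f (L₀ f))
    {f g : C(Simplex d, ℂ)} (h : ∀ w, ‖f w‖ ≤ (g w).re) (w : Simplex d) :
    ‖L₀ f w‖ ≤ (L₀ g w).re := by
  rw [← (hL₀ f w).tsum_eq]
  refine tsum_of_norm_bounded (Complex.hasSum_re (hL₀ g w)) fun γ => ?_
  rw [norm_mul, Complex.norm_real, Real.norm_of_nonneg (weight_pos s γ w).le, Complex.re_ofReal_mul]
  exact mul_le_mul_of_nonneg_left (h _) (weight_pos s γ w).le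

theorem transfer_nonneg (hL₀ : ∀ f : C(Simplex d, ℂ), IsTransfer s f (L₀ f))
    {f : C(Simplex d, ℂ)} (h : ∀ w, (f w).im = 0 ∧ 0 ≤ (f w).re) (w : Simplex d) :
    (L₀ f w).im = 0 ∧ 0 ≤ (L₀ f w).re := by
  constructor
  · refine (Complex.hasSum_im (hL₀ f w)).unique ?_
    simp [fun w => (h w).1, hasSum_zero]
  · refine (Complex.hasSum_re (hL₀ f w)).nonneg fun γ => ?_
    rw [Complex.re_ofReal_mul]
    exact mul_nonneg (weight_pos s γ w).le (h _).2

variable {L : C1 d →L[ℂ] C1 d} {lam c r B : ℝ} {h : C1 d} {p : C1 d → ℂ}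

theorem fn_iterate (hLL : ∀ f, fn (L f) = L₀ (fn f)) (k : ℕ) (f : C1 d) :
    fn (L^[k] f) = (L₀ ^ k) (fn f) := by
  induction k generalizing f with
  | zero => rfl
  | succ k ih => rw [Function.iterate_succ_apply, ih, hLL, pow_succ, mul_apply_eq_comp]

/-- Iterating positivity: a function dominated by the eigenfunction `g` stays so, up to the factor
`lam ^ k`. -/
theorem norm_pow_transfer_apply_le (hL₀ : ∀ f : C(Simplex d, ℂ), IsTransfer s f (L₀ f))
    {g : C(Simplex d, ℂ)} (hg : L₀ g = (lam : ℂ) • g) {f : C(Simplex d, ℂ)} {t : ℝ}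
    (hf : ∀ w, ‖f w‖ ≤ t * (g w).re) (k : ℕ) (w : Simplex d) :
    ‖(L₀ ^ k) f w‖ ≤ t * lam ^ k * (g w).re := by
  induction k generalizing w with
  | zero => simpa using hf w
  | succ k ih =>
    have h1 := norm_transfer_apply_le hL₀ (f := (L₀ ^ k) f) (g := ((t * lam ^ k : ℝ) : ℂ) • g)
      (fun w => by
        rw [ContinuousMap.smul_apply, smul_eq_mul, Complex.re_ofReal_mul]; exact ih w) w
    rw [map_smul, hg, ContinuousMap.smul_apply, ContinuousMap.smul_apply, smul_eq_mul, smul_eq_mul,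
      Complex.re_ofReal_mul, Complex.re_ofReal_mul] at h1
    rw [pow_succ', mul_apply_eq_comp]
    exact h1.trans_eq (by ring)

/-- The decay in `C¹(Δ)`, read in the weaker norm of `C⁰(Δ)`. -/
theorem norm_pow_fn_sub_le (hLL : ∀ f, fn (L f) = L₀ (fn f))
    (hdec : ∀ (g : C1 d) (k : ℕ),
      ‖L^[k] g - ((lam : ℂ) ^ k * p g) • h‖ ≤ B * (lam * r) ^ k * ‖g‖) (g : C1 d)
    (k : ℕ) :
    ‖(L₀ ^ k) (fn g) - ((lam : ℂ) ^ k * p g) • fn h‖ ≤ lam ^ k * (B * ‖g‖ * r ^ k) := by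
  have h1 := hdec g k
  rw [C1.norm_eq, fn_sub, fn_smul, fn_iterate hLL] at h1
  refine (le_add_of_nonneg_right (norm_nonneg _)).trans (h1.trans_eq ?_)
  rw [mul_pow]; ring

/-- The functionals `f ↦ lam^(-k) (ℒ^k f)(w₀)` are uniformly bounded on `C⁰(Δ)` by comparison with
`h`, and converge on `C¹(Δ)` by the spectral gap. Their limit is positive, and an eigenvector of
the dual operator. -/
theorem exists_eigenmeasure (hL₀ : ∀ f : C(Simplex d, ℂ), IsTransfer s f (L₀ f))
    (hLL : ∀ f, fn (L f) = L₀ (fn f)) (hlam : 0 < lam) (hr : 0 ≤ r) (hr1 : r < 1) (hc : 0 < c)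
    (hh : L h = (lam : ℂ) • h) (him : ∀ w, (fn h w).im = 0) (hre : ∀ w, c ≤ (fn h w).re)
    (hdec : ∀ (g : C1 d) (k : ℕ),
      ‖L^[k] g - ((lam : ℂ) ^ k * p g) • h‖ ≤ B * (lam * r) ^ k * ‖g‖) :
    ∃ ν : ProbabilityMeasure (Simplex d), IsEigenmeasure L₀ lam ν := by
  obtain ⟨w₀⟩ := simplex_nonempty (d := d)
  have hl0 : (lam : ℂ) ≠ 0 := by exact_mod_cast hlam.ne'
  have hg : L₀ (fn h) = (lam : ℂ) • fn h := by rw [← hLL, hh, fn_smul]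
  let A : ℕ → C(Simplex d, ℂ) →ₗ[ℂ] ℂ := fun k =>
    ((lam : ℂ) ^ k)⁻¹ • ((ContinuousMap.evalCLM ℂ w₀).comp (L₀ ^ k)).toLinearMap
  have hAdef : ∀ k f, A k f = ((lam : ℂ) ^ k)⁻¹ * (L₀ ^ k) f w₀ := fun _ _ => rfl
  have hAn : ∀ k f, ‖A k f‖ = (lam ^ k)⁻¹ * ‖(L₀ ^ k) f w₀‖ := fun k f => by
    rw [hAdef, norm_mul, norm_inv, norm_pow, Complex.norm_real, Real.norm_of_nonneg hlam.le]
  have hAb : ∀ k f, ‖A k f‖ ≤ ((fn h w₀).re / c) * ‖f‖ := by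
    intro k f
    have h1 := norm_pow_transfer_apply_le hL₀ hg (f := f) (t := ‖f‖ / c) (fun w => by
      have h2 := hre w
      have h3 := f.norm_coe_le_norm w
      rw [div_mul_eq_mul_div, le_div_iff₀ hc]
      nlinarith [norm_nonneg f, norm_nonneg (f w)]) k w₀
    rw [hAn, inv_mul_le_iff₀ (pow_pos hlam k)]
    exact h1.trans_eq (by ring)
  have hAfn : ∀ g : C1 d, Tendsto (fun k => A k (fn g)) atTop (𝓝 (p g * fn h w₀)) := by
    intro g
    rw [tendsto_iff_norm_sub_tendsto_zero]
    refine squeeze_zero (fun k => norm_nonneg _) (fun k => ?_)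
      (tendsto_mul_pow_zero hr hr1 (B * ‖g‖))
    have h1 := (ContinuousMap.norm_coe_le_norm _ w₀).trans (norm_pow_fn_sub_le hLL hdec g k)
    have h2 : A k (fn g) - p g * fn h w₀ =
        ((lam : ℂ) ^ k)⁻¹ * ((L₀ ^ k) (fn g) - ((lam : ℂ) ^ k * p g) • fn h) w₀ := by
      rw [hAdef, ContinuousMap.sub_apply, ContinuousMap.smul_apply, smul_eq_mul]
      field_simp
    rw [h2, norm_mul, norm_inv, norm_pow, Complex.norm_real, Real.norm_of_nonneg hlam.le,
      inv_mul_le_iff₀ (pow_pos hlam k)]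
    exact h1
  obtain ⟨Λ, hΛ⟩ := exists_limit_functional A hAb (denseRange_fnL (d := d)) (by
    rintro _ ⟨g, rfl⟩; exact (hAfn g).cauchySeq)
  have hpos : ∀ f : C(Simplex d, ℂ), (∀ x, (f x).im = 0 ∧ 0 ≤ (f x).re) →
      (Λ f).im = 0 ∧ 0 ≤ (Λ f).re := by
    intro f hf
    have h1 : ∀ k w, ((L₀ ^ k) f w).im = 0 ∧ 0 ≤ ((L₀ ^ k) f w).re := by
      intro k
      induction k with
      | zero => exact hf
      | succ k ih =>
        rw [pow_succ', mul_apply_eq_comp]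
        exact fun w => transfer_nonneg hL₀ ih w
    have h2 : ∀ k, A k f = (((lam ^ k)⁻¹ : ℝ) : ℂ) * (L₀ ^ k) f w₀ := fun k => by
      rw [hAdef]; push_cast; rfl
    constructor
    · refine tendsto_nhds_unique ((Complex.continuous_im.tendsto _).comp (hΛ f)) ?_
      refine tendsto_const_nhds.congr fun k => ?_
      rw [Function.comp_apply, h2, Complex.im_ofReal_mul, (h1 k w₀).1, mul_zero]
    · refine ge_of_tendsto' ((Complex.continuous_re.tendsto _).comp (hΛ f)) fun k => ?_
      simp only [Function.comp_apply, h2, Complex.re_ofReal_mul]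
      exact mul_nonneg (by positivity) (h1 k w₀).2
  have hΛT : ∀ f, Λ (L₀ f) = lam * Λ f := by
    intro f
    have h1 := ((hΛ f).comp (tendsto_add_atTop_nat 1)).const_mul (lam : ℂ)
    refine tendsto_nhds_unique (hΛ (L₀ f)) (h1.congr fun k => ?_)
    simp only [Function.comp_apply, hAdef, pow_succ L₀, pow_succ (lam : ℂ), mul_apply_eq_comp]
    field_simp
  have hΛh : Λ (fn h) = fn h w₀ := by
    have h1 := pow_apply_of_eigenvector hg
    refine tendsto_nhds_unique (hΛ (fn h)) (tendsto_const_nhds.congr fun k => ?_)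
    rw [hAdef, h1, ContinuousMap.smul_apply, smul_eq_mul]
    field_simp
  -- The limit does not vanish: `h ≤ ‖h‖`, and `Λ h = h(w₀) > 0`.
  have hΛ1 : 0 < (Λ 1).re := by
    have h1 := (hpos ((‖fn h‖ : ℂ) • 1 - fn h) fun w => ⟨by simp [him], by
      have := (Complex.re_le_norm (fn h w)).trans ((fn h).norm_coe_le_norm w)
      simpa using this⟩).2
    rw [map_sub, map_smul, hΛh, Complex.sub_re, smul_eq_mul, Complex.re_ofReal_mul,
      sub_nonneg] at h1
    exact pos_of_mul_pos_right ((hc.trans_le (hre w₀)).trans_le h1) (norm_nonneg _)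
  have hΛ1' : Λ 1 = ((Λ 1).re : ℂ) :=
    Complex.ext rfl (by simpa using (hpos 1 fun x => by simp).1)
  have hΛ1n : Λ 1 ≠ 0 := by
    rw [hΛ1']; exact_mod_cast hΛ1.ne'
  obtain ⟨ν, hν⟩ := exists_probabilityMeasure ((Λ 1)⁻¹ • Λ) (fun f hf => by
    have h1 := hpos f hf
    have h2 : ((Λ 1)⁻¹ • Λ) f = (((Λ 1).re⁻¹ : ℝ) : ℂ) * Λ f := by
      rw [LinearMap.smul_apply, smul_eq_mul, Complex.ofReal_inv, ← hΛ1']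
    rw [h2, Complex.im_ofReal_mul, Complex.re_ofReal_mul, h1.1, mul_zero]
    exact ⟨rfl, mul_nonneg (inv_nonneg.mpr hΛ1.le) h1.2⟩) (by simp [hΛ1n])
  refine ⟨ν, fun f => ?_⟩
  rw [hν, hν, LinearMap.smul_apply, LinearMap.smul_apply, hΛT, smul_eq_mul, smul_eq_mul]
  ring

theorem integrable_simplex (f : C(Simplex d, ℂ)) (ν : ProbabilityMeasure (Simplex d)) :
    Integrable f (ν : Measure (Simplex d)) :=
  f.continuous.integrable_of_hasCompactSupport (HasCompactSupport.of_compactSpace _)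

theorem norm_integral_simplex_le (f : C(Simplex d, ℂ)) (ν : ProbabilityMeasure (Simplex d)) :
    ‖∫ w, f w ∂(ν : Measure (Simplex d))‖ ≤ ‖f‖ := by
  simpa using norm_integral_le_of_norm_le_const (μ := (ν : Measure (Simplex d)))
    (Eventually.of_forall f.norm_coe_le_norm)

theorem integral_fn_eq (him : ∀ w, (fn h w).im = 0) (hre : ∀ w, c ≤ (fn h w).re)
    (ν : ProbabilityMeasure (Simplex d)) :
    ∃ J : ℝ, c ≤ J ∧ ∫ w, fn h w ∂(ν : Measure (Simplex d)) = J := by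
  have h1 : ∀ w, fn h w = ((fn h w).re : ℂ) := fun w => Complex.ext rfl (by simp [him])
  refine ⟨∫ w, (fn h w).re ∂(ν : Measure (Simplex d)), ?_, ?_⟩
  · have h2 := integral_mono (μ := (ν : Measure (Simplex d))) (integrable_const c)
      (integrable_simplex (fn h) ν).re hre
    simpa using h2
  · exact (integral_congr_ae (Eventually.of_forall h1)).trans integral_complex_ofReal

/-- An eigenmeasure for `lam` is a multiple of the functional `p` on `C¹(Δ)`, which is the reason
for its uniqueness. -/
theorem integral_eigenmeasure (hLL : ∀ f, fn (L f) = L₀ (fn f)) (hlam : 0 < lam) (hr : 0 ≤ r)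
    (hr1 : r < 1)
    (hdec : ∀ (g : C1 d) (k : ℕ),
      ‖L^[k] g - ((lam : ℂ) ^ k * p g) • h‖ ≤ B * (lam * r) ^ k * ‖g‖)
    {ν : ProbabilityMeasure (Simplex d)} (hν : IsEigenmeasure L₀ lam ν) (g : C1 d) :
    ∫ w, fn g w ∂(ν : Measure (Simplex d)) =
      p g * ∫ w, fn h w ∂(ν : Measure (Simplex d)) := by
  have h1 : ∀ (k : ℕ) (f : C(Simplex d, ℂ)), ∫ w, (L₀ ^ k) f w ∂(ν : Measure (Simplex d)) =
      (lam : ℂ) ^ k * ∫ w, f w ∂(ν : Measure (Simplex d)) := by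
    intro k f
    induction k with
    | zero => simp
    | succ k ih => rw [pow_succ', mul_apply_eq_comp, hν, ih, pow_succ']; ring
  rw [← sub_eq_zero]
  have h2 : ∀ k : ℕ, ‖∫ w, fn g w ∂(ν : Measure (Simplex d)) -
      p g * ∫ w, fn h w ∂(ν : Measure (Simplex d))‖ ≤ B * ‖g‖ * r ^ k := by
    intro k
    have h3 := (norm_integral_simplex_le _ ν).trans (norm_pow_fn_sub_le hLL hdec g k)
    have h4 : ∫ w, ((L₀ ^ k) (fn g) - ((lam : ℂ) ^ k * p g) • fn h) w ∂(ν : Measure (Simplex d)) =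
        (lam : ℂ) ^ k * (∫ w, fn g w ∂(ν : Measure (Simplex d)) -
          p g * ∫ w, fn h w ∂(ν : Measure (Simplex d))) := by
      simp only [ContinuousMap.sub_apply, ContinuousMap.smul_apply, smul_eq_mul]
      rw [integral_sub (integrable_simplex _ ν) ((integrable_simplex _ ν).const_mul _), h1,
        integral_const_mul]
      ring
    rw [h4, norm_mul, norm_pow, Complex.norm_real, Real.norm_of_nonneg hlam.le] at h3
    exact le_of_mul_le_mul_left h3 (pow_pos hlam k)
  exact norm_le_zero_iff.mp (ge_of_tendsto' (tendsto_mul_pow_zero hr hr1 (B * ‖g‖)) h2)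

theorem probabilityMeasure_ext_of_C1 {ν ν' : ProbabilityMeasure (Simplex d)}
    (h : ∀ g : C1 d, ∫ w, fn g w ∂(ν : Measure (Simplex d)) =
      ∫ w, fn g w ∂(ν' : Measure (Simplex d))) : ν = ν' := by
  have hcont : ∀ ν : ProbabilityMeasure (Simplex d),
      Continuous fun f : C(Simplex d, ℂ) => ∫ w, f w ∂(ν : Measure (Simplex d)) := by
    intro ν
    refine (LipschitzWith.of_dist_le_mul (K := 1) fun f g => ?_).continuous
    rw [dist_eq_norm, dist_eq_norm, ← integral_sub (integrable_simplex _ ν)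
      (integrable_simplex _ ν)]
    simpa using norm_integral_simplex_le (f - g) ν
  have h1 : (fun f : C(Simplex d, ℂ) => ∫ w, f w ∂(ν : Measure (Simplex d))) =
      fun f => ∫ w, f w ∂(ν' : Measure (Simplex d)) :=
    (denseRange_fnL (d := d)).equalizer (hcont ν) (hcont ν') (funext h)
  have key : (ν : Measure (Simplex d)) = ν' := by
    refine ext_of_forall_integral_eq_of_IsFiniteMeasure fun f => ?_
    have h2 := congrFun h1 ⟨fun w => (f w : ℂ), by fun_prop⟩
    simp only [ContinuousMap.coe_mk, integral_complex_ofReal] at h2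
    exact_mod_cast h2
  exact Subtype.ext key

/-- Integrating the positive function `h` shows that the eigenvalue of an eigenmeasure is `lam`. -/
theorem eigenmeasure_unique (hLL : ∀ f, fn (L f) = L₀ (fn f)) (hlam : 0 < lam) (hr : 0 ≤ r)
    (hr1 : r < 1) (hc : 0 < c)
    (hh : L h = (lam : ℂ) • h) (him : ∀ w, (fn h w).im = 0) (hre : ∀ w, c ≤ (fn h w).re)
    (hdec : ∀ (g : C1 d) (k : ℕ),
      ‖L^[k] g - ((lam : ℂ) ^ k * p g) • h‖ ≤ B * (lam * r) ^ k * ‖g‖)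
    {ν ν' : ProbabilityMeasure (Simplex d)} (hν : IsEigenmeasure L₀ lam ν) {μ : ℝ}
    (hν' : IsEigenmeasure L₀ μ ν') : μ = lam ∧ ν' = ν := by
  have hμ : μ = lam := by
    obtain ⟨J, hJ, hJ'⟩ := integral_fn_eq him hre ν'
    have h1 := hν' (fn h)
    rw [← hLL, hh, fn_smul] at h1
    simp only [ContinuousMap.smul_apply, smul_eq_mul, integral_const_mul, hJ'] at h1
    have h2 : lam * J = μ * J := by exact_mod_cast h1
    exact (mul_right_cancel₀ (hc.trans_le hJ).ne' h2).symm
  subst hμ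
  refine ⟨rfl, (probabilityMeasure_ext_of_C1 fun g => ?_).symm⟩
  have h1 := integral_eigenmeasure hLL hlam hr hr1 hdec hν
  have h2 := integral_eigenmeasure hLL hlam hr hr1 hdec hν'
  have e1 := h1 (C1.const 1)
  have e2 := h2 (C1.const 1)
  simp only [C1.fn_const, ContinuousMap.const_apply, integral_const, probReal_univ,
    one_smul] at e1 e2
  -- The two measures have the same mass, and the function `1` has `p 1 ≠ 0`.
  have hp1 : p (C1.const 1) ≠ 0 := by rintro h0; simp [h0] at e1
  rw [h1, h2]
  congr 1
  exact mul_left_cancel₀ hp1 (e1.symm.trans e2)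

end Eigenmeasure

/-! ### Spectral gap, uniformly in `s` -/

section Main

open MeasureTheory

variable {d : ℕ} {s : ℝ}

/-- The cone generates `C¹(Δ)`: adding a large constant moves a real function into it. The constant
`4 (d+1)²` combines `const_add_mem_logCone` with the bound for real and imaginary parts. -/
theorem exists_logCone_decomposition {a : ℝ} (ha : 1 ≤ a) (f : C1 d) :
    ∃ f₁ f₂ : C1 d, f = f₁ + Complex.I • f₂ ∧
      ((4 * (d + 1) ^ 2) * ‖f‖ : ℝ) • (C1.const 1 : C1 d) + f₁ ∈ logCone d a ∧
      ((4 * (d + 1) ^ 2) * ‖f‖ : ℝ) • (C1.const 1 : C1 d) - f₁ ∈ logCone d a ∧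
      ((4 * (d + 1) ^ 2) * ‖f‖ : ℝ) • (C1.const 1 : C1 d) + f₂ ∈ logCone d a ∧
      ((4 * (d + 1) ^ 2) * ‖f‖ : ℝ) • (C1.const 1 : C1 d) - f₂ ∈ logCone d a := by
  obtain ⟨f₁, f₂, hf, him₁, him₂, hn₁, hn₂⟩ := exists_real_imag f
  have hconst : ∀ c : ℝ, c • (C1.const 1 : C1 d) = C1.const (c : ℂ) := fun c =>
    C1.ext_fn (by ext w; simp)
  have key : ∀ g : C1 d, (∀ w, (fn g w).im = 0) → ‖g‖ ≤ 2 * (d + 1) ^ 2 * ‖f‖ →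
      ((4 * (d + 1) ^ 2) * ‖f‖ : ℝ) • (C1.const 1 : C1 d) + g ∈ logCone d a ∧
      ((4 * (d + 1) ^ 2) * ‖f‖ : ℝ) • (C1.const 1 : C1 d) - g ∈ logCone d a := by
    intro g hg hgn
    rw [hconst, sub_eq_add_neg]
    refine ⟨const_add_mem_logCone ha (by linarith) hg,
      const_add_mem_logCone ha (by linarith [norm_neg g]) fun w => ?_⟩
    have h1 : fn (-g) w = -fn g w := rfl
    rw [h1, Complex.neg_im, hg, neg_zero]
  exact ⟨f₁, f₂, hf, (key f₁ him₁ hn₁).1, (key f₁ him₁ hn₁).2, (key f₂ him₂ hn₂).1,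
    (key f₂ him₂ hn₂).2⟩

/-- All the assertions for a fixed `s`, with an explicit lower bound for the eigenvalue and with
`R(s) = lam (1 - gapConst s)`; the eigenfunction is normalised by its integral. -/
theorem exists_transfer_spectral_gap (hd : 0 < d) (hs : 1 < s) :
    ∃ lam : ℝ, (2 : ℝ) ^ (-s) / 11 ≤ lam ∧
      ∃ (L₀ : C(Simplex d, ℂ) →L[ℂ] C(Simplex d, ℂ)) (L : C1 d →L[ℂ] C1 d),
        (∀ f : C(Simplex d, ℂ), IsTransfer s f (L₀ f)) ∧
        (∀ f : C1 d, IsTransfer s (fn f) (fn (L f))) ∧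
        IsSimpleEigenvalue L lam ∧
        spectrum ℂ L \ {(lam : ℂ)} ⊆ Metric.closedBall 0 (lam * (1 - gapConst s)) ∧
        ∃ ν : ProbabilityMeasure (Simplex d), IsEigenmeasure L₀ lam ν ∧
          (∀ (μ : ℝ) (ν' : ProbabilityMeasure (Simplex d)),
            IsEigenmeasure L₀ μ ν' → μ = lam ∧ ν' = ν) ∧
          ∃ h : C1 d, L h = (lam : ℂ) • h ∧ ∫ w, fn h w ∂(ν : Measure (Simplex d)) = 1 ∧
            (∀ h' : C1 d, L h' = (lam : ℂ) • h' →
              ∫ w, fn h' w ∂(ν : Measure (Simplex d)) = 1 → h' = h) ∧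
            ∀ w, 0 < (fn h w).re ∧ (fn h w).im = 0 := by
  obtain ⟨L₀, L, hL₀, hLL, hL⟩ := exists_transfer (d := d) hs
  have hT : ∀ f : C1 d, IsTransfer s (fn f) (fn (L f)) := fun f => by rw [hLL]; exact hL₀ _
  obtain ⟨w₀⟩ := simplex_nonempty (d := d)
  have H := isConeContraction_transfer hs hL w₀
  have h1K : (C1.const 1 : C1 d) ∈ logCone d (12 * s) := by
    simpa using const_mem_logCone (d := d) zero_le_one (by linarith : 0 ≤ 12 * s)
  have h10 : (C1.const 1 : C1 d) ≠ 0 := fun h0 => by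
    have : (1 : ℂ) = 0 := congrArg (fun f : C1 d => fn f w₀) h0
    exact one_ne_zero this
  have hm : 0 < (2 : ℝ) ^ (-s) / 11 := by positivity
  obtain ⟨hl, M, hu⟩ := transfer_one_bounds hs hd hT hL
  have key := IsConeContraction.exists_simple_eigenvalue (E := C1 d) H h1K h10 hm hl hu
    (exists_logCone_decomposition (by linarith))
  obtain ⟨lam, c, B, h, p, hlam, hc, hK, hce, hh, hsimple, hspec, hunique, hdec⟩ := key
  have hlam0 : 0 < lam := hm.trans_le hlam
  have hr : 0 ≤ 1 - gapConst s := by linarith [gapConst_lt_one (by linarith : 0 ≤ s)]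
  have hr1 : 1 - gapConst s < 1 := by linarith [gapConst_pos s]
  have him : ∀ w, (fn h w).im = 0 := fun w => (hK w).1
  have hre : ∀ w, c ≤ (fn h w).re := fun w => by
    have h1 := (hce w).2.1
    rw [fn_sub, fn_real_smul, C1.fn_const] at h1
    simpa using h1
  obtain ⟨ν, hν⟩ := exists_eigenmeasure hL₀ hLL hlam0 hr hr1 hc hh him hre hdec
  obtain ⟨J, hcJ, hJ⟩ := integral_fn_eq him hre ν
  have hJ0 : 0 < J := hc.trans_le hcJ
  have hJ0' : (J : ℂ) ≠ 0 := by exact_mod_cast hJ0.ne'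
  have hint : ∀ t : ℂ, ∫ w, fn (t • h) w ∂(ν : Measure (Simplex d)) = t * J := fun t => by
    rw [fn_smul, ← hJ, ← integral_const_mul]
    rfl
  refine ⟨lam, hlam, L₀, L, hL₀, hT, hsimple, hspec, ν, hν,
    fun μ ν' hν' => eigenmeasure_unique hLL hlam0 hr hr1 hc hh him hre hdec hν hν',
    ((J⁻¹ : ℝ) : ℂ) • h, ?_, ?_, fun h' hh' hi => ?_, fun w => ?_⟩
  · rw [map_smul, hh, smul_comm]
  · rw [hint, Complex.ofReal_inv, inv_mul_cancel₀ hJ0']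
  · have h1 := hunique h' hh'
    rw [h1, hint] at hi
    rw [h1, Complex.ofReal_inv, eq_inv_of_mul_eq_one_left hi]
  · rw [fn_smul, ContinuousMap.smul_apply, smul_eq_mul, Complex.re_ofReal_mul,
      Complex.im_ofReal_mul, him, mul_zero]
    exact ⟨mul_pos (inv_pos.mpr hJ0) (hc.trans_le (hre w)), rfl⟩

/-- The lower bound `2^(-s) / 11` for the eigenvalue and `gapConst` are both decreasing in `s`, so
their values at the right end of an interval give a uniform gap. -/
theorem exists_forall_gap_le (a b : ℝ) :
    ∃ ε : ℝ, 0 < ε ∧ ∀ s ∈ Set.Icc a b, ε ≤ (2 : ℝ) ^ (-s) / 11 * gapConst s := by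
  refine ⟨(2 : ℝ) ^ (-b) / 11 * gapConst b, mul_pos (by positivity) (gapConst_pos b),
    fun s hs => ?_⟩
  have h1 : (2 : ℝ) ^ (-b) ≤ (2 : ℝ) ^ (-s) :=
    Real.rpow_le_rpow_of_exponent_le one_le_two (by linarith [hs.2])
  have h2 : gapConst b ≤ gapConst s := by
    unfold gapConst
    have : Real.exp (-(48 * b)) ≤ Real.exp (-(48 * s)) := Real.exp_le_exp.mpr (by linarith [hs.2])
    linarith
  exact mul_le_mul (by linarith) h2 (gapConst_pos b).le (by positivity)

end Main

end MarkoffHurwitz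

open MarkoffHurwitz

theorem theorem3p6 (n : ℕ) (hn : 3 ≤ n) :
    ∃ lam R : ℝ → ℝ,
      (∀ s : ℝ, 1 < s →
        ∃ (L₀ : C(Simplex (n - 2), ℂ) →L[ℂ] C(Simplex (n - 2), ℂ))
          (L : C1 (n - 2) →L[ℂ] C1 (n - 2)),
          (∀ f : C(Simplex (n - 2), ℂ), IsTransfer s f (L₀ f)) ∧
          (∀ f : C1 (n - 2), IsTransfer s (fn f) (fn (L f))) ∧
          0 < lam s ∧
          IsSimpleEigenvalue L (lam s) ∧
          0 ≤ R s ∧ R s < lam s ∧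
          spectrum ℂ L \ {(lam s : ℂ)} ⊆ Metric.closedBall 0 (R s) ∧
          ∃ ν : MeasureTheory.ProbabilityMeasure (Simplex (n - 2)),
            IsEigenmeasure L₀ (lam s) ν ∧
            (∀ (μ : ℝ) (ν' : MeasureTheory.ProbabilityMeasure (Simplex (n - 2))),
              IsEigenmeasure L₀ μ ν' → μ = lam s ∧ ν' = ν) ∧
            ∃ h : C1 (n - 2),
              L h = (lam s : ℂ) • h ∧
              ∫ w, fn h w ∂(ν : MeasureTheory.Measure (Simplex (n - 2))) = 1 ∧
              (∀ h' : C1 (n - 2), L h' = (lam s : ℂ) • h' →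
                ∫ w, fn h' w ∂(ν : MeasureTheory.Measure (Simplex (n - 2))) = 1 → h' = h) ∧
              ∀ w, 0 < (fn h w).re ∧ (fn h w).im = 0) ∧
      ∀ a b : ℝ, 1 < a → ∃ ε : ℝ, 0 < ε ∧ ∀ s ∈ Set.Icc a b, ε ≤ lam s - R s := by
  have hd : 0 < n - 2 := by omega
  choose! lam hlam hmain using fun s (hs : 1 < s) => exists_transfer_spectral_gap hd hs
  have hpos : ∀ s : ℝ, 1 < s → 0 < lam s := fun s hs =>
    (by positivity : 0 < (2 : ℝ) ^ (-s) / 11).trans_le (hlam s hs)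
  refine ⟨lam, fun s => lam s * (1 - gapConst s), fun s hs => ?_, fun a b ha => ?_⟩
  · obtain ⟨L₀, L, hL₀, hL, hsimple, hspec, hν⟩ := hmain s hs
    have h1 := gapConst_pos s
    have h2 := gapConst_lt_one (by linarith : 0 ≤ s)
    exact ⟨L₀, L, hL₀, hL, hpos s hs, hsimple, mul_nonneg (hpos s hs).le (by linarith),
      by nlinarith [hpos s hs], hspec, hν⟩
  · obtain ⟨ε, hε, hgap⟩ := exists_forall_gap_le a b
    refine ⟨ε, hε, fun s hs => (hgap s hs).trans ?_⟩
    have h1 := mul_le_mul_of_nonneg_right (hlam s (ha.trans_le hs.1)) (gapConst_pos s).le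
    linarith
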